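/- Let $n\ge 3$, $1<p<\infty$, and let $r,s$ be exponents with $0<r\le\infty$, $p\le s\le\infty$ (with the convention $1/\infty=0$) such that $$\frac1r-\frac1s=1-\frac2p,\qquad \frac12-\frac1p\le\frac1r\le 1-\frac1p,\qquad \frac1r+\frac1s<\frac2n .$$ Let $a\in L_r(\mathbb R^n)$ and $b\in L_s(\mathbb R^n)$ be complex-valued functions and put $q=ab$. Let $H$ be the Schrödinger operator $-\Delta+q$ in $L_p(\mathbb R^n)$, that is, the operator whose domain consists of all $u\in L_p(\mathbb R^n)$ such that $bu\in L_p(\mathbb R^n)$, $a(bu)$ is locally integrable and the distribution $-\Delta u+a(bu)$ belongs to $L_p(\mathbb R^n)$, with $Hu=-\Delta u+a(bu)$. Then every eigenvalue $\lambda\in\mathbb C$ of $H$ with $\operatorname{Im}\lambda\ne0$ satisfies $$|\operatorname{Im}\lambda|^{\alpha}\le(4\pi)^{\alpha-1}\,\Gamma(\alpha)\,\|a\|_r\,\|b\|_s,\qquad\text{where } \alpha=1-\frac n2\Bigl(\frac1r+\frac1s\Bigr).$$ -/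

import Mathlib

open MeasureTheory
open scoped ENNReal ContDiff

/-- The complex Lebesgue space `L_p(ℝⁿ)`. -/
abbrev ComplexLp (n : ℕ) (p : ℝ≥0∞) : Type :=
  Lp ℂ p (volume : Measure (EuclideanSpace ℝ (Fin n)))

/-- `φ ∈ C_c^∞(ℝⁿ; ℂ)`. -/
def IsTestFunction {n : ℕ} (φ : EuclideanSpace ℝ (Fin n) → ℂ) : Prop :=
  ContDiff ℝ ∞ φ ∧ HasCompactSupport φ

/-- `-Δ u + v = f` in the sense of distributions on `ℝⁿ`. -/
def WeakEq {n : ℕ} (u v f : EuclideanSpace ℝ (Fin n) → ℂ) : Prop :=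
  ∀ φ : EuclideanSpace ℝ (Fin n) → ℂ, IsTestFunction φ →
    (∫ x, u x * (-(Laplacian.laplacian φ x))) + (∫ x, v x * φ x) = ∫ x, f x * φ x

theorem IsTestFunction.continuous_laplacian {n : ℕ} {φ : EuclideanSpace ℝ (Fin n) → ℂ}
    (hφ : IsTestFunction φ) : Continuous (fun x => -(Laplacian.laplacian φ x)) := by
  rw [InnerProductSpace.laplacian_eq_iteratedFDeriv_stdOrthonormalBasis]
  refine (continuous_finsetSum _ fun i _ => ?_).neg
  have h := hφ.1.continuous_iteratedFDeriv (m := 2) (by norm_cast)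
  fun_prop

theorem IsTestFunction.hasCompactSupport_laplacian {n : ℕ}
    {φ : EuclideanSpace ℝ (Fin n) → ℂ} (hφ : IsTestFunction φ) :
    HasCompactSupport (fun x => -(Laplacian.laplacian φ x)) := by
  rw [InnerProductSpace.laplacian_eq_iteratedFDeriv_stdOrthonormalBasis]
  refine (hφ.2.iteratedFDeriv (𝕜 := ℝ) 2).mono fun x hx => ?_
  contrapose! hx
  simp only [Function.mem_support, not_not] at hx ⊢
  simp [hx]

theorem locallyIntegrable_mul_test {n : ℕ} {g ψ : EuclideanSpace ℝ (Fin n) → ℂ}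
    (hg : LocallyIntegrable g) (hψ : Continuous ψ) (hc : HasCompactSupport ψ) :
    Integrable (fun x => g x * ψ x) := by
  simpa [mul_comm] using hg.integrable_smul_left_of_hasCompactSupport hψ hc

theorem WeakEq.congr {n : ℕ} {u v f u' v' f' : EuclideanSpace ℝ (Fin n) → ℂ}
    (h : WeakEq u v f) (hu : u' =ᵐ[volume] u) (hv : v' =ᵐ[volume] v)
    (hf : f' =ᵐ[volume] f) : WeakEq u' v' f' := by
  intro φ hφ
  have key : ∀ {g g' : EuclideanSpace ℝ (Fin n) → ℂ} (ψ : EuclideanSpace ℝ (Fin n) → ℂ),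
      g' =ᵐ[volume] g → ∫ x, g' x * ψ x = ∫ x, g x * ψ x := fun ψ hg =>
    integral_congr_ae (hg.mono fun x hx => by simp only [hx])
  rw [key _ hu, key _ hv, key _ hf]
  exact h φ hφ

theorem WeakEq.add {n : ℕ} {u v f u' v' f' : EuclideanSpace ℝ (Fin n) → ℂ}
    (h : WeakEq u v f) (h' : WeakEq u' v' f')
    (hu : LocallyIntegrable u) (hv : LocallyIntegrable v) (hf : LocallyIntegrable f)
    (hu' : LocallyIntegrable u') (hv' : LocallyIntegrable v') (hf' : LocallyIntegrable f') :
    WeakEq (u + u') (v + v') (f + f') := by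
  intro φ hφ
  have hc := hφ.1.continuous
  simp only [Pi.add_apply, add_mul]
  rw [integral_add (locallyIntegrable_mul_test hu hφ.continuous_laplacian
        hφ.hasCompactSupport_laplacian)
      (locallyIntegrable_mul_test hu' hφ.continuous_laplacian hφ.hasCompactSupport_laplacian),
    integral_add (locallyIntegrable_mul_test hv hc hφ.2) (locallyIntegrable_mul_test hv' hc hφ.2),
    integral_add (locallyIntegrable_mul_test hf hc hφ.2) (locallyIntegrable_mul_test hf' hc hφ.2),
    ← h φ hφ, ← h' φ hφ]
  ring

theorem WeakEq.smul {n : ℕ} {u v f : EuclideanSpace ℝ (Fin n) → ℂ}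
    (h : WeakEq u v f) (c : ℂ) : WeakEq (c • u) (c • v) (c • f) := by
  intro φ hφ
  simp only [Pi.smul_apply, smul_eq_mul, mul_assoc, integral_const_mul, ← h φ hφ, mul_add]

theorem WeakEq.ae_eq_zero {n : ℕ} {f : EuclideanSpace ℝ (Fin n) → ℂ}
    (h : WeakEq 0 0 f) (hf : LocallyIntegrable f) : f =ᵐ[volume] 0 := by
  refine ae_eq_zero_of_integral_contDiff_smul_eq_zero hf fun g hg hc => ?_
  have ht : IsTestFunction (fun x : EuclideanSpace ℝ (Fin n) => (g x : ℂ)) :=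
    ⟨Complex.ofRealCLM.contDiff.comp hg, hc.comp_left (g := Complex.ofReal) Complex.ofReal_zero⟩
  have h2 := h _ ht
  simp only [Pi.zero_apply, zero_mul, integral_zero, add_zero] at h2
  rw [h2]
  refine integral_congr_ae (Filter.Eventually.of_forall fun x => ?_)
  simp only [Complex.real_smul, mul_comm]

theorem ComplexLp.locallyIntegrable {n : ℕ} {p : ℝ≥0∞} [hp : Fact (1 ≤ p)]
    (u : ComplexLp n p) : LocallyIntegrable (u : EuclideanSpace ℝ (Fin n) → ℂ) :=
  (Lp.memLp u).locallyIntegrable hp.out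

/-- The graph of the Schrödinger operator `-Δ + a b` in `L_p(ℝⁿ)`: the pairs `(u, f)` of elements
of `L_p` such that `u` lies in the maximal domain of multiplication by `b` (that is, `b u ∈ L_p`),
`a (b u)` is a distribution (that is, locally integrable), and `-Δ u + a (b u) = f` in the sense
of distributions. -/
def schrodingerGraph {n : ℕ} (p : ℝ≥0∞) [Fact (1 ≤ p)]
    (a b : EuclideanSpace ℝ (Fin n) → ℂ) :
    Submodule ℂ (ComplexLp n p × ComplexLp n p) where
  carrier := {w | MemLp (fun x => b x * w.1 x) p volume ∧
    LocallyIntegrable (fun x => a x * (b x * w.1 x)) volume ∧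
    WeakEq w.1 (fun x => a x * (b x * w.1 x)) w.2}
  add_mem' := by
    rintro w w' ⟨h1, h2, h3⟩ ⟨h1', h2', h3'⟩
    have e : (fun x => b x * (w + w').1 x) =ᵐ[volume]
        (fun x => b x * w.1 x) + fun x => b x * w'.1 x := by
      filter_upwards [Lp.coeFn_add w.1 w'.1] with x hx
      simp only [Prod.fst_add, Pi.add_apply] at hx ⊢
      rw [hx, mul_add]
    have e2 : (fun x => a x * (b x * (w + w').1 x)) =ᵐ[volume]
        (fun x => a x * (b x * w.1 x)) + fun x => a x * (b x * w'.1 x) := by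
      filter_upwards [e] with x hx
      simp only [Pi.add_apply] at hx ⊢
      rw [hx, mul_add]
    exact ⟨(memLp_congr_ae e).2 (h1.add h1'), (h2.add h2').congr e2.symm,
      (h3.add h3' (ComplexLp.locallyIntegrable _) h2 (ComplexLp.locallyIntegrable _)
        (ComplexLp.locallyIntegrable _) h2' (ComplexLp.locallyIntegrable _)).congr
        (Lp.coeFn_add w.1 w'.1) e2 (Lp.coeFn_add w.2 w'.2)⟩
  zero_mem' := by
    have e0 := Lp.coeFn_zero ℂ p (volume : Measure (EuclideanSpace ℝ (Fin n)))
    have e : (fun x => b x * (0 : ComplexLp n p × ComplexLp n p).1 x) =ᵐ[volume]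
        (0 : EuclideanSpace ℝ (Fin n) → ℂ) := by
      filter_upwards [e0] with x hx
      simp only [Prod.fst_zero, Pi.zero_apply] at hx ⊢
      rw [hx, mul_zero]
    have e2 : (fun x => a x * (b x * (0 : ComplexLp n p × ComplexLp n p).1 x)) =ᵐ[volume]
        (0 : EuclideanSpace ℝ (Fin n) → ℂ) := by
      filter_upwards [e] with x hx
      simp only [Pi.zero_apply] at hx ⊢
      rw [hx, mul_zero]
    refine ⟨(memLp_congr_ae e).2 MemLp.zero, locallyIntegrable_zero.congr e2.symm, ?_⟩
    refine WeakEq.congr (u := 0) (v := 0) (f := 0) ?_ e0 e2 e0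
    intro φ _
    simp
  smul_mem' := by
    rintro c w ⟨h1, h2, h3⟩
    have e : (fun x => b x * (c • w).1 x) =ᵐ[volume] c • fun x => b x * w.1 x := by
      filter_upwards [Lp.coeFn_smul c w.1] with x hx
      simp only [Prod.smul_fst, Pi.smul_apply, smul_eq_mul] at hx ⊢
      rw [hx]; ring
    have e2 : (fun x => a x * (b x * (c • w).1 x)) =ᵐ[volume]
        c • fun x => a x * (b x * w.1 x) := by
      filter_upwards [e] with x hx
      simp only [Pi.smul_apply, smul_eq_mul] at hx ⊢
      rw [hx]; ring
    exact ⟨(memLp_congr_ae e).2 (h1.const_smul c), (h2.smul c).congr e2.symm,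
      (h3.smul c).congr (Lp.coeFn_smul c w.1) e2 (Lp.coeFn_smul c w.2)⟩

/-- `schrodingerGraph` is the graph of an operator: `f` is determined by `u`. -/
theorem schrodingerGraph_unique {n : ℕ} (p : ℝ≥0∞) [Fact (1 ≤ p)]
    (a b : EuclideanSpace ℝ (Fin n) → ℂ) (w : ComplexLp n p × ComplexLp n p)
    (hw : w ∈ schrodingerGraph p a b) (h0 : w.1 = 0) : w.2 = 0 := by
  have h : WeakEq w.1 (fun x => a x * (b x * w.1 x)) w.2 := hw.2.2
  have e0 : w.1 =ᵐ[volume] (0 : EuclideanSpace ℝ (Fin n) → ℂ) := by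
    rw [h0]; exact Lp.coeFn_zero ℂ p _
  have e1 : (fun x => a x * (b x * w.1 x)) =ᵐ[volume] (0 : EuclideanSpace ℝ (Fin n) → ℂ) := by
    filter_upwards [e0] with x hx
    simp only [Pi.zero_apply] at hx ⊢
    rw [hx, mul_zero, mul_zero]
  have h' : WeakEq 0 0 (w.2 : EuclideanSpace ℝ (Fin n) → ℂ) :=
    h.congr e0.symm e1.symm (Filter.EventuallyEq.refl _ _)
  exact (Lp.eq_zero_iff_ae_eq_zero).2 (h'.ae_eq_zero (ComplexLp.locallyIntegrable w.2))

/-- The Schrödinger operator `H = -Δ + a b` in `L_p(ℝⁿ)`, an unbounded operator: its domain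
consists of the `u ∈ L_p` with `b u ∈ L_p` for which the distribution `-Δ u + a (b u)` belongs to
`L_p`, and `H u` is that element of `L_p`. -/
noncomputable def schrodingerOp {n : ℕ} (p : ℝ≥0∞) [Fact (1 ≤ p)]
    (a b : EuclideanSpace ℝ (Fin n) → ℂ) : ComplexLp n p →ₗ.[ℂ] ComplexLp n p :=
  (schrodingerGraph p a b).toLinearPMap

theorem schrodingerOp_graph {n : ℕ} (p : ℝ≥0∞) [Fact (1 ≤ p)]
    (a b : EuclideanSpace ℝ (Fin n) → ℂ) :
    (schrodingerOp p a b).graph = schrodingerGraph p a b :=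
  Submodule.toLinearPMap_graph_eq _ (schrodingerGraph_unique p a b)

/-- `z` is an eigenvalue of the unbounded operator `T`. -/
def IsEigenvalue {V : Type*} [AddCommGroup V] [Module ℂ V] (T : V →ₗ.[ℂ] V) (z : ℂ) : Prop :=
  ∃ u : T.domain, (u : V) ≠ 0 ∧ T u = z • (u : V)

/-! This is a Birman–Schwinger argument carried out by duality. Let `u` be an eigenfunction for `z`,
and put `v = b u` and `w = a v`. With `1/q = 1/r + 1/p`, Hölder gives `w ∈ L_q`, and `u = -(-Δ -
z)⁻¹ w` when tested against Schwartz functions. If the form of the resolvent on `L_q × L_q` is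
bounded by `C`, pairing `u` with functions `b η`, `η ∈ L_{p'}`, gives `‖v‖_p ≤ C ‖w‖_q ‖b‖_s ≤ C
‖a‖_r ‖b‖_s ‖v‖_p`. Since `v ≠ 0`, the norm cancels and `1 ≤ C ‖a‖_r ‖b‖_s`.

The constant `C = (4π)^(α-1) Γ(α) |Im z|^(-α)` comes from writing the resolvent as a Laplace
integral of the heat semigroup along a ray of complex times `ζ τ`, with `ζ` close to `± i`
(`integral_mul_schwartzResolvent`). At such times the kernel is at most `(4πτ)^(-n/2)` and the form
is a contraction on `L²`. Riesz–Thorin (`norm_kernel_form_le_eLpNorm`) yields `(4πτ)^(α-1)` on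
`L_q`, because `2/q - 1 = 1/r + 1/s`, and integrating this against `exp (-|Im z| τ)` produces the
Gamma function. The closing duality step is `eLpNorm_mul_le_of_pairing`. -/

section GaussianKernel

/-! ### The heat kernel at complex time: sup bound and `L²` contractivity. -/

set_option linter.unusedSectionVars false

open scoped FourierTransform RealInnerProductSpace

variable {V : Type*} [NormedAddCommGroup V] [InnerProductSpace ℝ V] [FiniteDimensional ℝ V]
  [MeasurableSpace V] [BorelSpace V]

/-- The Fourier transform of the complex Gaussian `ξ ↦ exp (-b ‖ξ‖²)`. -/
noncomputable def gaussKernel (b : ℂ) (x : V) : ℂ :=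
  (Real.pi / b) ^ (Module.finrank ℝ V / 2 : ℂ) * Complex.exp (-Real.pi ^ 2 * ‖x‖ ^ 2 / b)

theorem continuous_gaussKernel (b : ℂ) : Continuous (gaussKernel b : V → ℂ) := by
  unfold gaussKernel; fun_prop

/-- Since `Re (1/b) > 0`, the exponential has modulus at most one and only the prefactor survives.
-/
theorem norm_gaussKernel_le {b : ℂ} (hb : 0 < b.re) (x : V) :
    ‖gaussKernel b x‖ ≤ (Real.pi / ‖b‖) ^ (Module.finrank ℝ V / 2 : ℝ) := by
  have hb0 : b ≠ 0 := by rintro rfl; simp at hb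
  have h1 : (Module.finrank ℝ V / 2 : ℂ) = ((Module.finrank ℝ V / 2 : ℝ) : ℂ) := by push_cast; rfl
  have h2 : (Real.pi / b : ℂ) ≠ 0 := div_ne_zero (by exact_mod_cast Real.pi_ne_zero) hb0
  rw [gaussKernel, norm_mul, h1, Complex.norm_cpow_of_ne_zero h2, Complex.norm_exp]
  simp only [Complex.ofReal_re, Complex.ofReal_im, mul_zero, Real.exp_zero, div_one, norm_div,
    Complex.norm_real, Real.norm_eq_abs, abs_of_pos Real.pi_pos]
  refine mul_le_of_le_one_right (by positivity) (Real.exp_le_one_iff.2 ?_)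
  have h3 : (-(Real.pi : ℂ) ^ 2 * (‖x‖ : ℂ) ^ 2 / b) = ((-(Real.pi ^ 2 * ‖x‖ ^ 2) : ℝ) : ℂ) * b⁻¹ := by
    push_cast; ring
  rw [h3, Complex.re_ofReal_mul, Complex.inv_re]
  have := Complex.normSq_nonneg b
  have : 0 ≤ Real.pi ^ 2 * ‖x‖ ^ 2 * (b.re / Complex.normSq b) := by positivity
  linarith

theorem gaussKernel_ofReal {ε : ℝ} (hε : 0 < ε) (x : V) :
    gaussKernel (ε : ℂ) x =
      ((Real.pi / ε) ^ (Module.finrank ℝ V / 2 : ℝ) * Real.exp (-(Real.pi ^ 2 / ε) * ‖x‖ ^ 2) : ℝ) := by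
  have h1 : (Module.finrank ℝ V / 2 : ℂ) = ((Module.finrank ℝ V / 2 : ℝ) : ℂ) := by push_cast; rfl
  rw [gaussKernel, h1, Complex.ofReal_mul, Complex.ofReal_cpow (by positivity)]
  push_cast
  congr 2
  ring

theorem integral_norm_gaussKernel_ofReal {ε : ℝ} (hε : 0 < ε) :
    Integrable (fun x : V => ‖gaussKernel (ε : ℂ) x‖) ∧ ∫ x : V, ‖gaussKernel (ε : ℂ) x‖ = 1 := by
  have h : (fun x : V => ‖gaussKernel (ε : ℂ) x‖) = fun x : V =>
      (Real.pi / ε) ^ (Module.finrank ℝ V / 2 : ℝ) * Real.exp (-(Real.pi ^ 2 / ε) * ‖x‖ ^ 2) := by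
    funext x
    rw [gaussKernel_ofReal hε, Complex.norm_real, Real.norm_of_nonneg (by positivity)]
  have h2 : ∫ x : V, ‖gaussKernel (ε : ℂ) x‖ = 1 := by
    rw [h, integral_const_mul, GaussianFourier.integral_rexp_neg_mul_sq_norm (by positivity),
      ← Real.mul_rpow (by positivity) (by positivity)]
    have : Real.pi / ε * (Real.pi / (Real.pi ^ 2 / ε)) = 1 := by
      have := Real.pi_pos
      field_simp
    rw [this, Real.one_rpow]
  -- A Bochner integral with a nonzero value forces integrability, as the default value is zero.
  exact ⟨not_imp_comm.1 integral_undef (by rw [h2]; exact one_ne_zero), h2⟩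

theorem integral_fourier_mul_eq_of_integrable {f g : V → ℂ} (hf : Integrable f)
    (hg : Integrable g) : ∫ ξ, 𝓕 f ξ * g ξ = ∫ x, f x * 𝓕 g x := by
  simpa using! VectorFourier.integral_bilin_fourierIntegral_eq_flip (.mul ℂ ℂ) (L := innerₗ V)
    Real.continuous_fourierChar continuous_inner hf hg

theorem norm_fourier_le_integral_norm (f : V → ℂ) (ξ : V) : ‖𝓕 f ξ‖ ≤ ∫ x, ‖f x‖ :=
  VectorFourier.norm_fourierIntegral_le_integral_norm _ _ _ _ _

theorem norm_fourierInv_le_integral_norm (f : V → ℂ) (ξ : V) : ‖𝓕⁻ f ξ‖ ≤ ∫ x, ‖f x‖ := by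
  rw [Real.fourierInv_eq_fourier_neg]
  exact norm_fourier_le_integral_norm f _

theorem continuous_fourier_of_integrable {f : V → ℂ} (hf : Integrable f) : Continuous (𝓕 f) :=
  VectorFourier.fourierIntegral_continuous Real.continuous_fourierChar continuous_inner hf

theorem continuous_fourierInv_of_integrable {f : V → ℂ} (hf : Integrable f) :
    Continuous (𝓕⁻ f) := by
  have : 𝓕⁻ f = fun ξ => 𝓕 f (-ξ) := funext fun ξ => Real.fourierInv_eq_fourier_neg f ξ
  rw [this]
  exact (continuous_fourier_of_integrable hf).comp continuous_neg

theorem integrable_cexp_neg_mul_sq_norm {b : ℂ} (hb : 0 < b.re) :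
    Integrable (fun ξ : V => Complex.exp (-b * ‖ξ‖ ^ 2)) := by
  simpa using GaussianFourier.integrable_cexp_neg_mul_sq_norm_add (V := V) hb 0 0

/-- After `ξ ↦ -ξ` the transform moves from `f` onto the modulated Gaussian, whose transform is the
translated kernel. -/
theorem fourier_gaussian_mul_fourierInv {b : ℂ} (hb : 0 < b.re) {f : V → ℂ} (hf : Integrable f)
    (y : V) : 𝓕 (fun ξ => Complex.exp (-b * ‖ξ‖ ^ 2) * 𝓕⁻ f ξ) y =
      ∫ x, gaussKernel b (x - y) * f x := by
  have h1 : 𝓕 (fun ξ => Complex.exp (-b * ‖ξ‖ ^ 2) * 𝓕⁻ f ξ) y =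
      ∫ ξ, 𝓕 f ξ * Complex.exp (-b * ‖ξ‖ ^ 2 + 2 * Real.pi * Complex.I * ⟪y, ξ⟫) := by
    rw [Real.fourier_eq', ← integral_neg_eq_self]
    refine integral_congr_ae (.of_forall fun ξ => ?_)
    simp only [norm_neg, inner_neg_left, Real.fourierInv_eq_fourier_neg, neg_neg, smul_eq_mul]
    rw [Complex.exp_add, real_inner_comm]
    push_cast
    ring_nf
  rw [h1, integral_fourier_mul_eq_of_integrable hf]
  · refine integral_congr_ae (.of_forall fun x => ?_)
    simp only
    rw [fourier_gaussian_innerProductSpace' hb, gaussKernel, norm_sub_rev, mul_comm]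
  · exact GaussianFourier.integrable_cexp_neg_mul_sq_norm_add hb _ _

theorem integrable_gaussKernel_prod {b : ℂ} (hb : 0 < b.re) {f g : V → ℂ} (hf : Integrable f)
    (hg : Integrable g) : Integrable (fun p : V × V => gaussKernel b (p.1 - p.2) * (f p.1 * g p.2))
      (volume.prod volume) := by
  refine (hf.mul_prod hg).bdd_mul (c := (Real.pi / ‖b‖) ^ (Module.finrank ℝ V / 2 : ℝ)) ?_
    (.of_forall fun p => norm_gaussKernel_le hb _)
  exact ((continuous_gaussKernel b).comp (continuous_fst.sub continuous_snd)).aestronglyMeasurable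

/-- The bilinear form of the complex heat semigroup in terms of its integral kernel. -/
theorem integral_gaussian_mul_fourier {b : ℂ} (hb : 0 < b.re) {f g : V → ℂ} (hf : Integrable f)
    (hg : Integrable g) : ∫ ξ, Complex.exp (-b * ‖ξ‖ ^ 2) * (𝓕⁻ f ξ * 𝓕 g ξ) =
      ∫ p : V × V, gaussKernel b (p.1 - p.2) * (f p.1 * g p.2) ∂(volume.prod volume) := by
  have hi : Integrable (fun ξ : V => Complex.exp (-b * ‖ξ‖ ^ 2) * 𝓕⁻ f ξ) :=
    (integrable_cexp_neg_mul_sq_norm hb).mul_bdd (c := ∫ x, ‖f x‖)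
      (continuous_fourierInv_of_integrable hf).aestronglyMeasurable
      (.of_forall fun ξ => norm_fourierInv_le_integral_norm f ξ)
  calc _ = ∫ ξ, 𝓕 g ξ * (Complex.exp (-b * ‖ξ‖ ^ 2) * 𝓕⁻ f ξ) := by congr 1; ext ξ; ring
    _ = _ := by
      rw [integral_fourier_mul_eq_of_integrable hg hi,
        integral_prod_symm _ (integrable_gaussKernel_prod hb hf hg)]
      refine integral_congr_ae (.of_forall fun y => ?_)
      simp only
      rw [fourier_gaussian_mul_fourierInv hb hf, ← integral_const_mul]
      congr 1; ext x; ring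

theorem fourierInv_conj (f : V → ℂ) (ξ : V) :
    𝓕⁻ (fun x => starRingEnd ℂ (f x)) ξ = starRingEnd ℂ (𝓕 f ξ) := by
  rw [Real.fourierInv_eq', Real.fourier_eq', ← integral_conj]
  congr 1; ext x
  simp only [smul_eq_mul, map_mul, ← Complex.exp_conj, Complex.conj_I, Complex.conj_ofReal]
  push_cast
  ring_nf

/-- The Gaussian-weighted `L²` norm of the Fourier transform is at most the `L²` norm. -/
theorem integral_gaussian_mul_norm_fourier_sq_le {ε : ℝ} (hε : 0 < ε) {f : V → ℂ}
    (hf : Integrable f) (hf2 : Integrable fun x => ‖f x‖ ^ 2) :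
    ∫ ξ, Real.exp (-ε * ‖ξ‖ ^ 2) * ‖𝓕 f ξ‖ ^ 2 ≤ ∫ x, ‖f x‖ ^ 2 := by
  have hb : 0 < (ε : ℂ).re := by simpa
  have hfc : Integrable fun x => starRingEnd ℂ (f x) := by
    refine hf.norm.mono' ?_ (.of_forall fun x => by simp)
    exact Complex.continuous_conj.comp_aestronglyMeasurable hf.1
  -- Pairing `f` with its conjugate turns the weighted norm into the heat form at real time, where
  -- the kernel is positive with mass one. The Schur test then applies: `|f(x) f(y)| ≤ (|f(x)|² +
  -- |f(y)|²) / 2`, and each half integrates to half of `∫ |f|²`.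
  have h1 := integral_gaussian_mul_fourier hb hfc hf
  have h2 : ∫ ξ, Complex.exp (-(ε : ℂ) * ‖ξ‖ ^ 2) *
      (𝓕⁻ (fun x => starRingEnd ℂ (f x)) ξ * 𝓕 f ξ) =
      ((∫ ξ, Real.exp (-ε * ‖ξ‖ ^ 2) * ‖𝓕 f ξ‖ ^ 2 : ℝ) : ℂ) := by
    rw [← integral_complex_ofReal]
    congr 1; ext ξ
    rw [fourierInv_conj, mul_comm (starRingEnd ℂ _), Complex.mul_conj, Complex.normSq_eq_norm_sq]
    push_cast
    rfl
  obtain ⟨hk, hk1⟩ := integral_norm_gaussKernel_ofReal (V := V) hε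
  have i1 : Integrable (fun p : V × V => ‖gaussKernel (ε : ℂ) (p.1 - p.2)‖ * ‖f p.1‖ ^ 2)
      (volume.prod volume) ∧ ∫ p : V × V, ‖gaussKernel (ε : ℂ) (p.1 - p.2)‖ * ‖f p.1‖ ^ 2
        ∂(volume.prod volume) = ∫ x, ‖f x‖ ^ 2 := by
    have hm : AEStronglyMeasurable
        (fun p : V × V => ‖gaussKernel (ε : ℂ) (p.1 - p.2)‖ * ‖f p.1‖ ^ 2)
        (volume.prod volume) := by
      refine (((continuous_gaussKernel _).comp
        (continuous_fst.sub continuous_snd)).norm.aestronglyMeasurable).mul ?_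
      exact hf2.1.comp_fst
    have hi : Integrable (fun p : V × V => ‖gaussKernel (ε : ℂ) (p.1 - p.2)‖ * ‖f p.1‖ ^ 2)
      (volume.prod volume) := by
      rw [integrable_prod_iff hm]
      refine ⟨.of_forall fun x => (hk.comp_sub_left x).mul_const (‖f x‖ ^ 2), ?_⟩
      simp only [norm_mul, norm_norm, norm_pow]
      simp_rw [integral_mul_const, integral_sub_left_eq_self (fun x : V => ‖gaussKernel (ε : ℂ) x‖),
        hk1, one_mul]
      exact hf2
    refine ⟨hi, ?_⟩
    rw [integral_prod _ hi]
    simp_rw [integral_mul_const, integral_sub_left_eq_self (fun x : V => ‖gaussKernel (ε : ℂ) x‖),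
        hk1, one_mul]
  have i2 : Integrable (fun p : V × V => ‖gaussKernel (ε : ℂ) (p.1 - p.2)‖ * ‖f p.2‖ ^ 2)
      (volume.prod volume) ∧ ∫ p : V × V, ‖gaussKernel (ε : ℂ) (p.1 - p.2)‖ * ‖f p.2‖ ^ 2
        ∂(volume.prod volume) = ∫ x, ‖f x‖ ^ 2 := by
    have he : (fun p : V × V => ‖gaussKernel (ε : ℂ) (p.1 - p.2)‖ * ‖f p.2‖ ^ 2) =
        (fun p : V × V => ‖gaussKernel (ε : ℂ) (p.1 - p.2)‖ * ‖f p.1‖ ^ 2) ∘ Prod.swap := by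
      ext p
      simp [gaussKernel, norm_sub_rev]
    rw [he]
    refine ⟨i1.1.swap, ?_⟩
    rw [← i1.2]
    exact integral_prod_swap (fun p : V × V => ‖gaussKernel (ε : ℂ) (p.1 - p.2)‖ * ‖f p.1‖ ^ 2)
  rw [← Complex.norm_of_nonneg (r := ∫ ξ, Real.exp (-ε * ‖ξ‖ ^ 2) * ‖𝓕 f ξ‖ ^ 2)
    (integral_nonneg fun ξ => by positivity), ← h2, h1]
  calc _ ≤ ∫ p : V × V, (‖gaussKernel (ε : ℂ) (p.1 - p.2)‖ * ‖f p.1‖ ^ 2 +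
        ‖gaussKernel (ε : ℂ) (p.1 - p.2)‖ * ‖f p.2‖ ^ 2) / 2 ∂(volume.prod volume) := by
        refine norm_integral_le_of_norm_le ((i1.1.add i2.1).div_const 2) (.of_forall fun p => ?_)
        simp only [norm_mul, RCLike.norm_conj]
        rw [← mul_add, mul_div_assoc]
        gcongr
        nlinarith [sq_nonneg (‖f p.1‖ - ‖f p.2‖)]
    _ = _ := by
      rw [integral_div, integral_add i1.1 i2.1, i1.2, i2.2]
      ring

/-- On the Fourier side the Gaussian weight has modulus `exp (-Re b ‖ξ‖²)`. Half of it goes to each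
factor, Cauchy–Schwarz applies, and the real-time bound with `ε = Re b` controls both factors. -/
theorem norm_gaussKernel_form_le {b : ℂ} (hb : 0 < b.re) {f g : V → ℂ} (hf : Integrable f)
    (hg : Integrable g) (hf2 : Integrable fun x => ‖f x‖ ^ 2) (hg2 : Integrable fun x => ‖g x‖ ^ 2) :
    ‖∫ p : V × V, gaussKernel b (p.1 - p.2) * (f p.1 * g p.2) ∂(volume.prod volume)‖ ≤
      (∫ x, ‖f x‖ ^ 2) ^ (1 / 2 : ℝ) * (∫ x, ‖g x‖ ^ 2) ^ (1 / 2 : ℝ) := by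
  rw [← integral_gaussian_mul_fourier hb hf hg]
  have hw : Integrable (fun ξ : V => Real.exp (-b.re * ‖ξ‖ ^ 2)) := by
    refine (integrable_cexp_neg_mul_sq_norm (V := V) hb).norm.congr (.of_forall fun ξ => ?_)
    simp only [Complex.norm_exp]
    congr 1
    rw [← Complex.ofReal_pow, Complex.re_mul_ofReal, Complex.neg_re]
  have key : ∀ {h : V → ℂ} {A : ℝ}, Continuous h → (∀ ξ, ‖h ξ‖ ≤ A) →
      MemLp (fun ξ : V => Real.exp (-b.re * ‖ξ‖ ^ 2 / 2) * ‖h ξ‖) (ENNReal.ofReal 2) ∧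
      ∀ ξ, (Real.exp (-b.re * ‖ξ‖ ^ 2 / 2) * ‖h ξ‖) ^ (2 : ℝ) =
        Real.exp (-b.re * ‖ξ‖ ^ 2) * ‖h ξ‖ ^ 2 := by
    intro h A hc hA
    have he : ∀ ξ, (Real.exp (-b.re * ‖ξ‖ ^ 2 / 2) * ‖h ξ‖) ^ 2 =
        Real.exp (-b.re * ‖ξ‖ ^ 2) * ‖h ξ‖ ^ 2 := by
      intro ξ
      rw [mul_pow, ← Real.exp_nat_mul]
      congr 2
      push_cast; ring
    constructor
    · rw [ENNReal.ofReal_ofNat, memLp_two_iff_integrable_sq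
        (by fun_prop : Continuous _).aestronglyMeasurable]
      simp_rw [he]
      refine hw.mul_bdd (c := A ^ 2) (by fun_prop : Continuous _).aestronglyMeasurable
        (.of_forall fun ξ => ?_)
      rw [norm_pow, norm_norm]
      exact pow_le_pow_left₀ (norm_nonneg _) (hA ξ) 2
    · intro ξ
      rw [← he ξ]; norm_cast
  obtain ⟨mf, ef⟩ := key (continuous_fourierInv_of_integrable hf) (norm_fourierInv_le_integral_norm f)
  obtain ⟨mg, eg⟩ := key (continuous_fourier_of_integrable hg) (norm_fourier_le_integral_norm g)
  have hol := integral_mul_le_Lp_mul_Lq_of_nonneg (μ := (volume : Measure V))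
    Real.HolderConjugate.two_two (.of_forall fun ξ => by positivity)
    (.of_forall fun ξ => by positivity) mf mg
  simp_rw [ef, eg] at hol
  have hinv : ∫ ξ : V, Real.exp (-b.re * ‖ξ‖ ^ 2) * ‖𝓕⁻ f ξ‖ ^ 2 ≤ ∫ x, ‖f x‖ ^ 2 := by
    refine le_trans (le_of_eq ?_) (integral_gaussian_mul_norm_fourier_sq_le hb hf hf2)
    rw [← integral_neg_eq_self]
    simp only [norm_neg, Real.fourierInv_eq_fourier_neg, neg_neg]
  calc _ ≤ ∫ ξ : V, ‖Complex.exp (-b * ‖ξ‖ ^ 2) * (𝓕⁻ f ξ * 𝓕 g ξ)‖ :=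
        norm_integral_le_integral_norm _
    _ = ∫ ξ : V, (Real.exp (-b.re * ‖ξ‖ ^ 2 / 2) * ‖𝓕⁻ f ξ‖) *
        (Real.exp (-b.re * ‖ξ‖ ^ 2 / 2) * ‖𝓕 g ξ‖) := by
      congr 1; ext ξ
      have : Real.exp (-b.re * ‖ξ‖ ^ 2) =
          Real.exp (-b.re * ‖ξ‖ ^ 2 / 2) * Real.exp (-b.re * ‖ξ‖ ^ 2 / 2) := by
        rw [← Real.exp_add]; ring_nf
      rw [norm_mul, norm_mul, Complex.norm_exp, ← Complex.ofReal_pow, Complex.re_mul_ofReal,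
        Complex.neg_re, this]
      ring
    _ ≤ _ := hol
    _ ≤ _ := by
      have h2 := integral_gaussian_mul_norm_fourier_sq_le hb hg hg2
      have h3 : 0 ≤ ∫ ξ : V, Real.exp (-b.re * ‖ξ‖ ^ 2) * ‖𝓕⁻ f ξ‖ ^ 2 :=
        integral_nonneg fun ξ => by positivity
      have h4 : 0 ≤ ∫ ξ : V, Real.exp (-b.re * ‖ξ‖ ^ 2) * ‖𝓕 g ξ‖ ^ 2 :=
        integral_nonneg fun ξ => by positivity
      gcongr

end GaussianKernel

theorem toReal_eLpNorm_le_add {α : Type*} [MeasurableSpace α] {μ : Measure α} {f g : α → ℂ}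
    {q : ℝ≥0∞} (hq : 1 ≤ q) (hf : MemLp f q μ) (hg : MemLp g q μ) :
    (eLpNorm g q μ).toReal ≤ (eLpNorm f q μ).toReal + (eLpNorm (f - g) q μ).toReal := by
  rw [← ENNReal.toReal_add hf.2.ne (hf.sub hg).2.ne]
  refine ENNReal.toReal_mono (ENNReal.add_ne_top.2 ⟨hf.2.ne, (hf.sub hg).2.ne⟩) ?_
  rw [eLpNorm_sub_comm]
  calc eLpNorm g q μ = eLpNorm (f + (g - f)) q μ := by simp
    _ ≤ _ := eLpNorm_add_le hf.1 (hg.sub hf).1 hq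

/-! ### Riesz–Thorin interpolation for bilinear forms with a bounded kernel. -/

section Interpolation

set_option linter.unusedSectionVars false

open Complex.HadamardThreeLines

/-- The analytic family of powers `sgn c · |c| ^ (q (1 + z) / 2)`. -/
noncomputable def signedPower (q : ℝ) (z c : ℂ) : ℂ :=
  if c = 0 then 0 else Complex.exp (q * (1 + z) / 2 * Real.log ‖c‖) * (c / ‖c‖)

theorem signedPower_zero (q : ℝ) (z : ℂ) : signedPower q z 0 = 0 := by simp [signedPower]

theorem differentiable_signedPower (q : ℝ) (c : ℂ) :
    Differentiable ℂ fun z => signedPower q z c := by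
  unfold signedPower
  split_ifs
  · fun_prop
  · fun_prop

theorem norm_signedPower {q : ℝ} {z : ℂ} (c : ℂ) (h : q * (1 + z.re) / 2 ≠ 0) :
    ‖signedPower q z c‖ = ‖c‖ ^ (q * (1 + z.re) / 2) := by
  by_cases hc : c = 0
  · simp [hc, signedPower_zero, Real.zero_rpow h]
  have hc' : 0 < ‖c‖ := norm_pos_iff.2 hc
  have : (q * (1 + z) / 2 : ℂ).re = q * (1 + z.re) / 2 := by
    rw [show (q * (1 + z) / 2 : ℂ) = ((q / 2 : ℝ) : ℂ) * (1 + z) by push_cast; ring,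
      Complex.re_ofReal_mul]
    simp; ring
  rw [signedPower, if_neg hc, norm_mul, Complex.norm_exp, norm_div, Complex.norm_real, norm_norm,
    div_self hc'.ne', mul_one, Complex.re_mul_ofReal, this, Real.rpow_def_of_pos hc', mul_comm]

theorem signedPower_eq_self {q : ℝ} {z : ℂ} (c : ℂ) (h : q * (1 + z) / 2 = 1) :
    signedPower q z c = c := by
  by_cases hc : c = 0
  · simp [hc, signedPower_zero]
  have hc' : (‖c‖ : ℂ) ≠ 0 := by simpa using hc
  rw [signedPower, if_neg hc, h, one_mul, ← Complex.ofReal_exp, Real.exp_log (norm_pos_iff.2 hc),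
    mul_div_cancel₀ _ hc']

variable {α : Type*} [MeasurableSpace α] {μ : Measure α} [SFinite μ]

theorem integrable_kernel_mul {K : α × α → ℂ} {M : ℝ}
    (hK : AEStronglyMeasurable K (μ.prod μ)) (hM : ∀ p, ‖K p‖ ≤ M) {f g : α → ℂ}
    (hf : Integrable f μ) (hg : Integrable g μ) :
    Integrable (fun p : α × α => K p * (f p.1 * g p.2)) (μ.prod μ) :=
  (hf.mul_prod hg).bdd_mul hK (.of_forall hM)

theorem norm_kernel_form_le {K : α × α → ℂ} {M : ℝ} (hM : ∀ p, ‖K p‖ ≤ M) {f g : α → ℂ}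
    (hf : Integrable f μ) (hg : Integrable g μ) :
    ‖∫ p, K p * (f p.1 * g p.2) ∂(μ.prod μ)‖ ≤ M * ((∫ x, ‖f x‖ ∂μ) * ∫ x, ‖g x‖ ∂μ) := by
  rw [← integral_prod_mul (fun x => ‖f x‖) (fun x => ‖g x‖), ← integral_const_mul]
  refine norm_integral_le_of_norm_le ((hf.norm.mul_prod hg.norm).const_mul M)
    (.of_forall fun p => ?_)
  rw [norm_mul, norm_mul]
  exact mul_le_mul_of_nonneg_right (hM p) (by positivity)

theorem simpleFunc_comp_eq_sum (f : SimpleFunc α ℂ) {φ : ℂ → ℂ} (hφ : φ 0 = 0) (x : α) :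
    φ (f x) = ∑ c ∈ f.range with c ≠ 0, φ c * (f ⁻¹' {c}).indicator 1 x := by
  by_cases h : f x = 0
  · rw [h, hφ, Finset.sum_eq_zero]
    intro c hc
    rw [Set.indicator_of_notMem, mul_zero]
    rintro hx
    exact (Finset.mem_filter.1 hc).2 (by rw [← h]; exact hx.symm)
  · rw [Finset.sum_eq_single (f x)]
    · simp
    · intro c _ hcx
      rw [Set.indicator_of_notMem, mul_zero]
      exact fun hx => hcx hx.symm
    · intro hx
      exact absurd (Finset.mem_filter.2 ⟨f.mem_range_self x, h⟩) hx

theorem integrable_indicator_preimage {f : SimpleFunc α ℂ} (hf : Integrable f μ) {c : ℂ}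
    (hc : c ≠ 0) : Integrable ((f ⁻¹' {c}).indicator (1 : α → ℂ)) μ := by
  rw [integrable_indicator_iff (f.measurableSet_preimage _)]
  exact integrableOn_const (f.measure_preimage_lt_top_of_integrable hf hc).ne

/-- For `φ = signedPower q z` all dependence on `z` sits in finitely many coefficients, so
holomorphy and boundedness on the strip can be checked termwise. Dropping the value zero keeps the
level sets of finite measure. -/
theorem kernel_form_comp_eq_sum {K : α × α → ℂ} {M : ℝ}
    (hK : AEStronglyMeasurable K (μ.prod μ)) (hM : ∀ p, ‖K p‖ ≤ M) {f g : SimpleFunc α ℂ}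
    (hf : Integrable f μ) (hg : Integrable g μ) {φ : ℂ → ℂ} (hφ : φ 0 = 0) :
    ∫ p, K p * (φ (f p.1) * φ (g p.2)) ∂(μ.prod μ) =
      ∑ c ∈ f.range with c ≠ 0, ∑ d ∈ g.range with d ≠ 0, φ c * φ d *
        ∫ p, K p * ((f ⁻¹' {c}).indicator 1 p.1 * (g ⁻¹' {d}).indicator 1 p.2) ∂(μ.prod μ) := by
  have hi : ∀ c ∈ f.range.filter (· ≠ 0), ∀ d ∈ g.range.filter (· ≠ 0),
      Integrable (fun p : α × α => φ c * φ d *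
        (K p * ((f ⁻¹' {c}).indicator 1 p.1 * (g ⁻¹' {d}).indicator 1 p.2))) (μ.prod μ) :=
    fun c hc d hd => (integrable_kernel_mul hK hM
      (integrable_indicator_preimage hf (Finset.mem_filter.1 hc).2)
      (integrable_indicator_preimage hg (Finset.mem_filter.1 hd).2)).const_mul _
  simp_rw [← integral_const_mul]
  rw [Finset.sum_congr rfl fun c hc => (integral_finsetSum _ (hi c hc)).symm,
    ← integral_finsetSum _ fun c hc => integrable_finsetSum _ (hi c hc)]
  congr 1; ext p
  rw [simpleFunc_comp_eq_sum f hφ, simpleFunc_comp_eq_sum g hφ, Finset.sum_mul_sum, Finset.mul_sum]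
  refine Finset.sum_congr rfl fun c _ => ?_
  rw [Finset.mul_sum]
  refine Finset.sum_congr rfl fun d _ => ?_
  ring

/-- The Riesz–Thorin theorem for a bounded kernel whose form is a contraction on `L²`, on simple
functions. -/
theorem norm_kernel_form_simpleFunc_le {K : α × α → ℂ} {M : ℝ}
    (hK : AEStronglyMeasurable K (μ.prod μ)) (hM : ∀ p, ‖K p‖ ≤ M) (hM0 : 0 ≤ M)
    (hL2 : ∀ f g : α → ℂ, Integrable f μ → Integrable g μ → Integrable (fun x => ‖f x‖ ^ 2) μ →
      Integrable (fun x => ‖g x‖ ^ 2) μ → ‖∫ p, K p * (f p.1 * g p.2) ∂(μ.prod μ)‖ ≤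
        (∫ x, ‖f x‖ ^ 2 ∂μ) ^ (1 / 2 : ℝ) * (∫ x, ‖g x‖ ^ 2 ∂μ) ^ (1 / 2 : ℝ))
    {q : ℝ} (hq1 : 1 ≤ q) (hq2 : q ≤ 2) {f g : SimpleFunc α ℂ}
    (hf : Integrable f μ) (hg : Integrable g μ) :
    ‖∫ p, K p * (f p.1 * g p.2) ∂(μ.prod μ)‖ ≤
      M ^ (2 / q - 1) * ((∫ x, ‖f x‖ ^ q ∂μ) ^ q⁻¹ * (∫ x, ‖g x‖ ^ q ∂μ) ^ q⁻¹) := by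
  have hq0 : 0 < q := by linarith
  set F : ℂ → ℂ := fun z =>
    ∫ p, K p * (signedPower q z (f p.1) * signedPower q z (g p.2)) ∂(μ.prod μ) with hF
  have hFs : ∀ z, F z = _ := fun z =>
    kernel_form_comp_eq_sum hK hM hf hg (signedPower_zero q z)
  have hd : Differentiable ℂ F := by
    rw [funext hFs]
    refine Differentiable.fun_sum fun c _ => Differentiable.fun_sum fun d _ => ?_
    exact ((differentiable_signedPower q c).mul (differentiable_signedPower q d)).mul_const _
  have hbd : BddAbove ((norm ∘ F) '' verticalClosedStrip 0 1) := by
    have hb : ∀ c : ℂ, ∀ z ∈ verticalClosedStrip 0 1,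
        ‖signedPower q z c‖ ≤ (1 + ‖c‖) ^ q := by
      intro c z hz
      have h0 : 0 ≤ z.re := hz.1
      have h1 : z.re ≤ 1 := hz.2
      rw [norm_signedPower c (by positivity)]
      calc ‖c‖ ^ (q * (1 + z.re) / 2) ≤ (1 + ‖c‖) ^ (q * (1 + z.re) / 2) :=
            Real.rpow_le_rpow (norm_nonneg c) (by linarith) (by positivity)
        _ ≤ (1 + ‖c‖) ^ q := Real.rpow_le_rpow_of_exponent_le (by linarith [norm_nonneg c])
            (by nlinarith)
    refine ⟨∑ c ∈ f.range with c ≠ 0, ∑ d ∈ g.range with d ≠ 0, (1 + ‖c‖) ^ q * (1 + ‖d‖) ^ q *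
        ‖∫ p, K p * ((f ⁻¹' {c}).indicator 1 p.1 * (g ⁻¹' {d}).indicator 1 p.2) ∂(μ.prod μ)‖, ?_⟩
    rintro _ ⟨z, hz, rfl⟩
    simp only [Function.comp_apply, hFs]
    refine (norm_sum_le _ _).trans (Finset.sum_le_sum fun c _ => (norm_sum_le _ _).trans
      (Finset.sum_le_sum fun d _ => ?_))
    rw [norm_mul, norm_mul]
    have := hb c z hz
    have := hb d z hz
    gcongr
  have hmem : ∀ {h : SimpleFunc α ℂ}, Integrable h μ → ∀ z,
      Integrable (fun x => signedPower q z (h x)) μ ∧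
      Integrable (fun x => ‖signedPower q z (h x)‖ ^ 2) μ := by
    intro h hh z
    have hs : h.FinMeasSupp μ := SimpleFunc.integrable_iff_finMeasSupp.1 hh
    have h1 : (h.map (signedPower q z)).FinMeasSupp μ := hs.map (signedPower_zero q z)
    have h2 : (h.map fun c => ‖signedPower q z c‖ ^ 2).FinMeasSupp μ :=
      hs.map (by simp [signedPower_zero])
    exact ⟨SimpleFunc.integrable_iff_finMeasSupp.2 h1, SimpleFunc.integrable_iff_finMeasSupp.2 h2⟩
  set A := ∫ x, ‖f x‖ ^ q ∂μ with hA
  set B := ∫ x, ‖g x‖ ^ q ∂μ with hB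
  have hA0 : 0 ≤ A := integral_nonneg fun x => by positivity
  have hB0 : 0 ≤ B := integral_nonneg fun x => by positivity
  -- On `Re z = 0` the powers have modulus `|c|^(q/2)`, so the `L²` bound is in terms of `∫ |f|^q`;
  -- on `Re z = 1` the modulus is `|c|^q` and the sup bound on the kernel gives the same integrals.
  have e0 : ∀ z : ℂ, z.re = 0 → ∀ c, ‖signedPower q z c‖ ^ 2 = ‖c‖ ^ q := by
    intro z hz c
    rw [norm_signedPower c (by rw [hz]; positivity), hz, ← Real.rpow_natCast,
      ← Real.rpow_mul (norm_nonneg c)]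
    congr 1; push_cast; ring
  have e1 : ∀ z : ℂ, z.re = 1 → ∀ c, ‖signedPower q z c‖ = ‖c‖ ^ q := by
    intro z hz c
    rw [norm_signedPower c (by rw [hz]; positivity), hz]
    congr 1; ring
  have hedge0 : ∀ z ∈ Complex.re ⁻¹' {0}, ‖F z‖ ≤ A ^ (1 / 2 : ℝ) * B ^ (1 / 2 : ℝ) := by
    intro z hz
    refine (hL2 _ _ (hmem hf z).1 (hmem hg z).1 (hmem hf z).2 (hmem hg z).2).trans (le_of_eq ?_)
    simp only [e0 z hz, hA, hB]
  have hedge1 : ∀ z ∈ Complex.re ⁻¹' {1}, ‖F z‖ ≤ M * (A * B) := by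
    intro z hz
    refine (norm_kernel_form_le hM (hmem hf z).1 (hmem hg z).1).trans (le_of_eq ?_)
    simp only [e1 z hz, hA, hB]
  -- At this `θ` the exponent `q (1 + θ) / 2` equals one, so the analytic family returns `f` and `g`
  -- themselves.
  set θ : ℝ := 2 / q - 1 with hθ
  have hθ0 : 0 ≤ θ := by rw [hθ, sub_nonneg, le_div_iff₀ hq0]; linarith
  have hθ1 : θ ≤ 1 := by
    rw [hθ, sub_le_iff_le_add, div_le_iff₀ hq0]; linarith
  have h3 := norm_le_interp_of_mem_verticalClosedStrip₀₁' F (z := (θ : ℂ))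
    ⟨by simpa using hθ0, by simpa using hθ1⟩ hd.diffContOnCl hbd hedge0 hedge1
  have hself : ∀ c, signedPower q (θ : ℂ) c = c := fun c => by
    refine signedPower_eq_self c ?_
    have : q * (1 + θ) / 2 = 1 := by rw [hθ]; field_simp; ring
    exact_mod_cast this
  simp only [hF, hself, Complex.ofReal_re] at h3
  refine h3.trans (le_of_eq ?_)
  have hexp : 1 / 2 * (1 - θ) + θ = q⁻¹ := by rw [hθ]; field_simp; ring
  have hpow : ∀ {C : ℝ}, 0 ≤ C → C ^ (1 / 2 * (1 - θ)) * C ^ θ = C ^ q⁻¹ := fun {C} hC => by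
    rw [← Real.rpow_add_of_nonneg hC (by nlinarith) hθ0, hexp]
  rw [Real.mul_rpow (by positivity) (by positivity), Real.mul_rpow hM0 (by positivity),
    Real.mul_rpow hA0 hB0, ← Real.rpow_mul hA0, ← Real.rpow_mul hB0, ← hpow hA0, ← hpow hB0]
  ring

/-- The Riesz–Thorin theorem for a bounded kernel whose form is a contraction on `L²`. -/
theorem norm_kernel_form_le_eLpNorm {K : α × α → ℂ} {M : ℝ}
    (hK : AEStronglyMeasurable K (μ.prod μ)) (hM : ∀ p, ‖K p‖ ≤ M) (hM0 : 0 ≤ M)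
    (hL2 : ∀ f g : α → ℂ, Integrable f μ → Integrable g μ → Integrable (fun x => ‖f x‖ ^ 2) μ →
      Integrable (fun x => ‖g x‖ ^ 2) μ → ‖∫ p, K p * (f p.1 * g p.2) ∂(μ.prod μ)‖ ≤
        (∫ x, ‖f x‖ ^ 2 ∂μ) ^ (1 / 2 : ℝ) * (∫ x, ‖g x‖ ^ 2 ∂μ) ^ (1 / 2 : ℝ))
    {q : ℝ≥0∞} (hq1 : 1 ≤ q) (hq2 : q ≤ 2) {f g : α → ℂ}
    (hf : Integrable f μ) (hg : Integrable g μ) (hfq : MemLp f q μ) (hgq : MemLp g q μ) :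
    ‖∫ p, K p * (f p.1 * g p.2) ∂(μ.prod μ)‖ ≤
      M ^ (2 / q.toReal - 1) * ((eLpNorm f q μ).toReal * (eLpNorm g q μ).toReal) := by
  have hqt : q ≠ ⊤ := (hq2.trans_lt (by simp)).ne
  have hq0 : q ≠ 0 := (zero_lt_one.trans_le hq1).ne'
  have hqr1 : 1 ≤ q.toReal := by
    simpa using (ENNReal.toReal_le_toReal ENNReal.one_ne_top hqt).2 hq1
  have hqr2 : q.toReal ≤ 2 := by
    simpa using (ENNReal.toReal_le_toReal hqt (by simp : (2 : ℝ≥0∞) ≠ ⊤)).2 hq2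
  -- One sequence must serve two limits: `L¹` convergence passes to the limit in the form, whose
  -- kernel is bounded, and convergence of the `L_q` norms passes to the limit in the bound.
  have approx : ∀ {h : α → ℂ}, Integrable h μ → MemLp h q μ → ∃ s : ℕ → SimpleFunc α ℂ,
      (∀ n, Integrable (s n) μ) ∧ (∀ n, MemLp (s n) q μ) ∧
      Filter.Tendsto (fun n => ∫ x, ‖s n x - h x‖ ∂μ) Filter.atTop (nhds 0) ∧
      Filter.Tendsto (fun n => (eLpNorm (s n) q μ).toReal) Filter.atTop
        (nhds (eLpNorm h q μ).toReal) := by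
    intro h hi hq
    set h' := hi.1.mk h
    have hm : Measurable h' := hi.1.stronglyMeasurable_mk.measurable
    have he : h =ᵐ[μ] h' := hi.1.ae_eq_mk
    have hi' : Integrable h' μ := hi.congr he
    have hq' : MemLp h' q μ := hq.ae_eq he
    set s := fun n => SimpleFunc.approxOn h' hm (Set.range h' ∪ {0}) 0 (by simp) n
    have hsi : ∀ n, Integrable (s n) μ := SimpleFunc.integrable_approxOn_range hm hi'
    have hsq : ∀ n, MemLp (s n) q μ := SimpleFunc.memLp_approxOn_range hm hq'
    refine ⟨s, hsi, hsq, ?_, ?_⟩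
    · have := SimpleFunc.tendsto_approxOn_range_L1_enorm hm hi'
      have h2 := (ENNReal.tendsto_toReal ENNReal.zero_ne_top).comp this
      refine h2.congr fun n => ?_
      simp only [Function.comp_apply]
      rw [integral_congr_ae (g := fun x => ‖s n x - h' x‖) (by
        filter_upwards [he] with x hx; rw [hx]), integral_norm_eq_lintegral_enorm
        (f := fun x => s n x - h' x) ((hsi n).sub hi').1]
    · rw [eLpNorm_congr_ae he]
      have h0 := SimpleFunc.tendsto_approxOn_range_Lp_eLpNorm hqt hm hq'.2
      have h1 := (ENNReal.tendsto_toReal ENNReal.zero_ne_top).comp h0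
      rw [tendsto_iff_dist_tendsto_zero]
      refine squeeze_zero (fun n => dist_nonneg) (fun n => ?_) h1
      simp only [Function.comp_apply]
      have k1 := toReal_eLpNorm_le_add hq1 hq' (hsq n)
      have k2 := toReal_eLpNorm_le_add hq1 (hsq n) hq'
      rw [eLpNorm_sub_comm] at k1
      rw [Real.dist_eq, abs_le]
      constructor <;> linarith
  obtain ⟨s, hs1, hsq, hsl, hsn⟩ := approx hf hfq
  obtain ⟨t, ht1, htq, htl, htn⟩ := approx hg hgq
  have hsimple : ∀ n, ‖∫ p, K p * (s n p.1 * t n p.2) ∂(μ.prod μ)‖ ≤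
      M ^ (2 / q.toReal - 1) * ((eLpNorm (s n) q μ).toReal * (eLpNorm (t n) q μ).toReal) := by
    intro n
    refine (norm_kernel_form_simpleFunc_le hK hM hM0 hL2 hqr1 hqr2 (hs1 n) (ht1 n)).trans
      (le_of_eq ?_)
    rw [(hsq n).eLpNorm_eq_integral_rpow_norm hq0 hqt, (htq n).eLpNorm_eq_integral_rpow_norm hq0 hqt,
      ENNReal.toReal_ofReal (by positivity), ENNReal.toReal_ofReal (by positivity)]
  have hlim : Filter.Tendsto (fun n => ∫ p, K p * (s n p.1 * t n p.2) ∂(μ.prod μ)) Filter.atTop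
      (nhds (∫ p, K p * (f p.1 * g p.2) ∂(μ.prod μ))) := by
    rw [tendsto_iff_norm_sub_tendsto_zero]
    have hb : ∀ n, ‖∫ p, K p * (s n p.1 * t n p.2) ∂(μ.prod μ) -
        ∫ p, K p * (f p.1 * g p.2) ∂(μ.prod μ)‖ ≤
        M * ((∫ x, ‖s n x - f x‖ ∂μ) * ((∫ x, ‖t n x - g x‖ ∂μ) + ∫ x, ‖g x‖ ∂μ)) +
        M * ((∫ x, ‖f x‖ ∂μ) * ∫ x, ‖t n x - g x‖ ∂μ) := by
      intro n
      have i1 := (hs1 n).sub hf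
      have i2 := (ht1 n).sub hg
      have hsplit : ∫ p, K p * (s n p.1 * t n p.2) ∂(μ.prod μ) -
          ∫ p, K p * (f p.1 * g p.2) ∂(μ.prod μ) =
          (∫ p, K p * ((⇑(s n) - f) p.1 * t n p.2) ∂(μ.prod μ)) +
          ∫ p, K p * (f p.1 * (⇑(t n) - g) p.2) ∂(μ.prod μ) := by
        rw [← integral_sub (integrable_kernel_mul hK hM (hs1 n) (ht1 n))
          (integrable_kernel_mul hK hM hf hg),
          ← integral_add (integrable_kernel_mul hK hM i1 (ht1 n))
          (integrable_kernel_mul hK hM hf i2)]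
        congr 1; ext p
        simp only [Pi.sub_apply]; ring
      rw [hsplit]
      refine (norm_add_le _ _).trans (add_le_add ((norm_kernel_form_le hM i1 (ht1 n)).trans ?_)
        (norm_kernel_form_le hM hf i2))
      have : ∫ x, ‖t n x‖ ∂μ ≤ (∫ x, ‖t n x - g x‖ ∂μ) + ∫ x, ‖g x‖ ∂μ := by
        have i3 : Integrable (fun x => ‖t n x - g x‖) μ := i2.norm
        rw [← integral_add i3 hg.norm]
        refine integral_mono (ht1 n).norm (i3.add hg.norm) fun x => ?_
        simpa using norm_add_le (t n x - g x) (g x)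
      simp only [Pi.sub_apply]
      have h0 : 0 ≤ ∫ x, ‖s n x - f x‖ ∂μ := integral_nonneg fun x => norm_nonneg _
      gcongr
    refine squeeze_zero (fun n => norm_nonneg _) hb ?_
    have := ((hsl.mul (htl.add_const (∫ x, ‖g x‖ ∂μ))).const_mul M).add
      ((htl.const_mul (∫ x, ‖f x‖ ∂μ)).const_mul M)
    simpa using this
  exact le_of_tendsto_of_tendsto' hlim.norm ((hsn.mul htn).const_mul _) hsimple

end Interpolation

/-! ### Hölder pairings and density of simple functions. -/

section Holder

variable {α : Type*} [MeasurableSpace α] {μ : Measure α}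

theorem norm_integral_mul_le_eLpNorm_mul_eLpNorm {f g : α → ℂ} {p q : ℝ≥0∞}
    [ENNReal.HolderConjugate p q] (hf : MemLp f p μ) (hg : MemLp g q μ) :
    ‖∫ x, f x * g x ∂μ‖ ≤ (eLpNorm f p μ).toReal * (eLpNorm g q μ).toReal := by
  have hi : Integrable (fun x => f x * g x) μ := MemLp.integrable_mul hf hg
  have h : eLpNorm (f • g) 1 μ ≤ eLpNorm f p μ * eLpNorm g q μ :=
    eLpNorm_smul_le_mul_eLpNorm (p := p) (q := q) (r := 1) hg.1 hf.1
  calc ‖∫ x, f x * g x ∂μ‖ ≤ ∫ x, ‖f x * g x‖ ∂μ := norm_integral_le_integral_norm _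
    _ = (eLpNorm (f • g) 1 μ).toReal := by
      rw [integral_norm_eq_lintegral_enorm hi.1, eLpNorm_one_eq_lintegral_enorm]
      rfl
    _ ≤ (eLpNorm f p μ * eLpNorm g q μ).toReal :=
      ENNReal.toReal_mono (ENNReal.mul_ne_top hf.2.ne hg.2.ne) h
    _ = _ := ENNReal.toReal_mul

/-- Pairing with `φ ∈ L_{q'}` is continuous on `L_q`, where simple functions are dense. This later
removes the assumption `f ∈ L¹` from the resolvent bound. -/
theorem norm_integral_mul_le_of_simpleFunc {q q' : ℝ≥0∞} [ENNReal.HolderConjugate q q']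
    (hq1 : 1 ≤ q) (hqt : q ≠ ⊤) {φ : α → ℂ} (hφ : MemLp φ q' μ) {C : ℝ} (hC : 0 ≤ C)
    (hs : ∀ g : SimpleFunc α ℂ, MemLp g q μ →
      ‖∫ x, g x * φ x ∂μ‖ ≤ C * (eLpNorm g q μ).toReal)
    {f : α → ℂ} (hf : MemLp f q μ) : ‖∫ x, f x * φ x ∂μ‖ ≤ C * (eLpNorm f q μ).toReal := by
  have happ : ∀ δ : ℝ, 0 < δ → ‖∫ x, f x * φ x ∂μ‖ ≤
      C * ((eLpNorm f q μ).toReal + δ) + δ * (eLpNorm φ q' μ).toReal := by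
    intro δ hδ
    obtain ⟨g, hg1, hg2⟩ := hf.exists_simpleFunc_eLpNorm_sub_lt hqt (ENNReal.ofReal_pos.2 hδ).ne'
    have hd := hf.sub hg2
    have hdn : (eLpNorm (f - ⇑g) q μ).toReal ≤ δ := ENNReal.toReal_le_of_le_ofReal hδ.le hg1.le
    have hgn : (eLpNorm g q μ).toReal ≤ (eLpNorm f q μ).toReal + δ := by
      have := toReal_eLpNorm_le_add hq1 hf hg2
      linarith
    have i1 : Integrable (fun x => g x * φ x) μ := MemLp.integrable_mul hg2 hφ
    have i2 : Integrable (fun x => (f - ⇑g) x * φ x) μ := MemLp.integrable_mul hd hφ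
    have hsum : ∫ x, f x * φ x ∂μ = (∫ x, g x * φ x ∂μ) + ∫ x, (f - ⇑g) x * φ x ∂μ := by
      rw [← integral_add i1 i2]
      congr 1; ext x
      simp only [Pi.sub_apply]; ring
    rw [hsum]
    refine (norm_add_le _ _).trans (add_le_add ((hs g hg2).trans ?_)
      ((norm_integral_mul_le_eLpNorm_mul_eLpNorm hd hφ).trans ?_))
    · gcongr
    · gcongr
  have hlim : Filter.Tendsto (fun δ : ℝ => C * ((eLpNorm f q μ).toReal + δ) +
      δ * (eLpNorm φ q' μ).toReal) (nhdsWithin 0 (Set.Ioi 0))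
      (nhds (C * (eLpNorm f q μ).toReal)) := by
    have : Continuous (fun δ : ℝ => C * ((eLpNorm f q μ).toReal + δ) +
      δ * (eLpNorm φ q' μ).toReal) := by fun_prop
    simpa using (this.tendsto 0).mono_left (nhdsWithin_le_nhds (s := Set.Ioi 0))
  refine ge_of_tendsto hlim ?_
  filter_upwards [self_mem_nhdsWithin] with δ hδ using happ δ hδ

end Holder

/-! ### The resolvent of the Laplacian and its bound on `L_q × L_q`. -/

section Resolvent

set_option linter.unusedSectionVars false

open scoped FourierTransform RealInnerProductSpace SchwartzMap

variable {V : Type*} [NormedAddCommGroup V] [InnerProductSpace ℝ V] [FiniteDimensional ℝ V]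
  [MeasurableSpace V] [BorelSpace V]

/-- The multiplier is that of `exp (ζ τ Δ)` in the normalisation with `2π` in the phase. As `‖ζ‖ ≥
1`, its kernel is at most `(4πτ)^(-n/2)`, and interpolation with `L²` raises this to the power `2/q
- 1`. -/
theorem norm_heat_form_le {ζ : ℂ} (hζ : 0 < ζ.re) (hζ1 : 1 ≤ ‖ζ‖) {τ : ℝ} (hτ : 0 < τ)
    {q : ℝ≥0∞} (hq1 : 1 ≤ q) (hq2 : q ≤ 2) {f g : V → ℂ}
    (hf : Integrable f) (hg : Integrable g) (hfq : MemLp f q) (hgq : MemLp g q) :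
    ‖∫ ξ, Complex.exp (-(ζ * τ * (2 * Real.pi) ^ 2) * ‖ξ‖ ^ 2) * (𝓕⁻ f ξ * 𝓕 g ξ)‖ ≤
      (4 * Real.pi * τ) ^ (-(Module.finrank ℝ V / 2 * (2 / q.toReal - 1)) : ℝ) *
        ((eLpNorm f q).toReal * (eLpNorm g q).toReal) := by
  set b : ℂ := ζ * τ * (2 * Real.pi) ^ 2 with hb
  have hbe : b = ((τ * (2 * Real.pi) ^ 2 : ℝ) : ℂ) * ζ := by rw [hb]; push_cast; ring
  have hpos : 0 < τ * (2 * Real.pi) ^ 2 := by positivity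
  have hbre : 0 < b.re := by rw [hbe, Complex.re_ofReal_mul]; positivity
  have hbn : τ * (2 * Real.pi) ^ 2 ≤ ‖b‖ := by
    rw [hbe, norm_mul, Complex.norm_real, Real.norm_of_nonneg hpos.le]
    exact le_mul_of_one_le_right hpos.le hζ1
  have hM : ∀ x : V, ‖gaussKernel b x‖ ≤ (4 * Real.pi * τ)⁻¹ ^ (Module.finrank ℝ V / 2 : ℝ) := by
    intro x
    refine (norm_gaussKernel_le hbre x).trans (Real.rpow_le_rpow (by positivity) ?_ (by positivity))
    calc Real.pi / ‖b‖ ≤ Real.pi / (τ * (2 * Real.pi) ^ 2) := by gcongr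
      _ = (4 * Real.pi * τ)⁻¹ := by
        have := Real.pi_pos
        field_simp; norm_num
  rw [integral_gaussian_mul_fourier hbre hf hg]
  refine (norm_kernel_form_le_eLpNorm (K := fun p : V × V => gaussKernel b (p.1 - p.2))
    ((continuous_gaussKernel b).comp (continuous_fst.sub continuous_snd)).aestronglyMeasurable
    (fun p => hM _) (by positivity) (fun f g h1 h2 h3 h4 => norm_gaussKernel_form_le hbre h1 h2 h3 h4)
    hq1 hq2 hf hg hfq hgq).trans (le_of_eq ?_)
  rw [Real.inv_rpow (by positivity), ← Real.rpow_neg (by positivity), ← Real.rpow_mul (by positivity)]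
  congr 2
  ring

theorem ofReal_sub_ne_zero {z : ℂ} (hz : z.im ≠ 0) (t : ℝ) : (t : ℂ) - z ≠ 0 := fun h =>
  hz (by simpa using congrArg Complex.im h)

theorem iteratedDeriv_inv_ofReal_sub {z : ℂ} (hz : z.im ≠ 0) (k : ℕ) :
    iteratedDeriv k (fun t : ℝ => ((t : ℂ) - z)⁻¹) =
      fun t : ℝ => (-1) ^ k * (k.factorial : ℂ) * (((t : ℂ) - z)⁻¹) ^ (k + 1) := by
  induction k with
  | zero => ext t; simp
  | succ k ih =>
    rw [iteratedDeriv_succ, ih]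
    ext t
    have h1 : HasDerivAt (fun t : ℝ => ((t : ℂ) - z)⁻¹) (-1 / ((t : ℂ) - z) ^ 2) t :=
      ((Complex.ofRealCLM.hasDerivAt (x := t)).sub_const z).inv (ofReal_sub_ne_zero hz t)
    have h2 := ((h1.pow (k + 1)).const_mul ((-1) ^ k * (k.factorial : ℂ))).deriv
    refine Eq.trans ?_ (h2.trans ?_)
    · rfl
    · rw [Nat.factorial_succ]
      push_cast
      rw [div_eq_mul_inv, ← inv_pow]
      ring

/-- Every derivative is bounded because `|t - z| ≥ |Im z|`. Hence the resolvent symbol is a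
multiplier of Schwartz space. -/
theorem hasTemperateGrowth_inv_ofReal_sub {z : ℂ} (hz : z.im ≠ 0) :
    (fun t : ℝ => ((t : ℂ) - z)⁻¹).HasTemperateGrowth := by
  refine ⟨?_, fun k => ⟨0, k.factorial * (|z.im|⁻¹) ^ (k + 1), fun t => ?_⟩⟩
  · exact (Complex.ofRealCLM.contDiff.sub contDiff_const).inv fun t => ofReal_sub_ne_zero hz t
  · rw [norm_iteratedFDeriv_eq_norm_iteratedDeriv, iteratedDeriv_inv_ofReal_sub hz]
    simp only [norm_mul, norm_pow, norm_neg, norm_one, one_pow, one_mul, pow_zero, mul_one,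
      Complex.norm_natCast, norm_inv]
    have : |z.im| ≤ ‖(t : ℂ) - z‖ := by
      simpa using Complex.abs_im_le_norm ((t : ℂ) - z)
    have : 0 < |z.im| := abs_pos.2 hz
    gcongr

/-- The symbol of the resolvent `(-Δ - z)⁻¹`. -/
noncomputable def resolventSymbol (z : ℂ) (ξ : V) : ℂ :=
  ((((2 * Real.pi) ^ 2 * ‖ξ‖ ^ 2 : ℝ) : ℂ) - z)⁻¹

theorem hasTemperateGrowth_resolventSymbol {z : ℂ} (hz : z.im ≠ 0) :
    (resolventSymbol z : V → ℂ).HasTemperateGrowth :=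
  (hasTemperateGrowth_inv_ofReal_sub hz).comp
    (f := fun ξ : V => (2 * Real.pi) ^ 2 * ‖ξ‖ ^ 2)
    ((Function.HasTemperateGrowth.const _).mul (Function.hasTemperateGrowth_norm_sq V))

/-- The resolvent `(-Δ - z)⁻¹` on Schwartz functions. -/
noncomputable def schwartzResolvent (z : ℂ) (ψ : 𝓢(V, ℂ)) : 𝓢(V, ℂ) :=
  SchwartzMap.fourierMultiplierCLM ℂ (resolventSymbol z) ψ

theorem schwartzResolvent_apply {z : ℂ} (hz : z.im ≠ 0) (ψ : 𝓢(V, ℂ)) (x : V) :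
    schwartzResolvent z ψ x = 𝓕⁻ (fun ξ => resolventSymbol z ξ * 𝓕 (ψ : V → ℂ) ξ) x := by
  rw [schwartzResolvent, SchwartzMap.fourierMultiplierCLM_apply, SchwartzMap.fourierInv_coe]
  refine congrArg (fun h : V → ℂ => 𝓕⁻ h x) (funext fun ξ => ?_)
  rw [SchwartzMap.smulLeftCLM_apply_apply (hasTemperateGrowth_resolventSymbol hz), smul_eq_mul,
    SchwartzMap.fourier_coe]

theorem laplacian_schwartzResolvent {z : ℂ} (hz : z.im ≠ 0) (ψ : 𝓢(V, ℂ)) (x : V) :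
    -(Laplacian.laplacian (schwartzResolvent z ψ : V → ℂ) x) =
      ψ x + z * schwartzResolvent z ψ x := by
  have hn : (fun ξ : V => ‖ξ‖ ^ 2).HasTemperateGrowth := Function.hasTemperateGrowth_norm_sq V
  have hnc : (fun ξ : V => ((‖ξ‖ ^ 2 : ℝ) : ℂ)).HasTemperateGrowth := by fun_prop
  have h : Laplacian.laplacian (schwartzResolvent z ψ) = -(ψ + z • schwartzResolvent z ψ) := by
    rw [SchwartzMap.laplacian_eq_fourierMultiplierCLM]
    have e1 : SchwartzMap.fourierMultiplierCLM ℂ (‖·‖ ^ 2 : V → ℝ) (schwartzResolvent z ψ) =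
      SchwartzMap.fourierMultiplierCLM ℂ (fun ξ : V => ((‖ξ‖ ^ 2 : ℝ) : ℂ))
        (schwartzResolvent z ψ) := (SchwartzMap.fourierMultiplierCLM_ofReal ℂ hn _).symm
    rw [e1]
    -- On the Fourier side the claim is that the symbol times `4π² ‖ξ‖² - z` is one.
    apply (FourierTransform.fourierEquiv ℂ 𝓢(V, ℂ)).injective
    simp only [FourierTransform.fourierEquiv_apply]
    rw [schwartzResolvent, SchwartzMap.fourierMultiplierCLM_apply,
      SchwartzMap.fourierMultiplierCLM_apply, FourierTransform.fourier_neg,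
      FourierTransform.fourier_add, FourierTransform.fourier_smul, FourierTransform.fourier_smul,
      FourierTransform.fourier_fourierInv_eq, FourierTransform.fourier_fourierInv_eq]
    ext ξ
    simp only [SchwartzMap.smulLeftCLM_apply_apply hnc, smul_apply, neg_apply, add_apply,
      SchwartzMap.smulLeftCLM_apply_apply (hasTemperateGrowth_resolventSymbol hz), smul_eq_mul,
      Complex.real_smul]
    have h0 := mul_inv_cancel₀ (ofReal_sub_ne_zero hz ((2 * Real.pi) ^ 2 * ‖ξ‖ ^ 2))
    rw [resolventSymbol]
    push_cast at h0 ⊢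
    linear_combination (-(𝓕 ψ) ξ) * h0
  rw [← SchwartzMap.laplacian_apply, h]
  simp

theorem integral_mul_fourierInv_eq {f g : V → ℂ} (hf : Integrable f) (hg : Integrable g) :
    ∫ x, f x * 𝓕⁻ g x = ∫ ξ, 𝓕⁻ f ξ * g ξ := by
  have hf' : Integrable fun x => f (-x) := hf.comp_neg
  rw [← integral_neg_eq_self]
  simp only [Real.fourierInv_eq_fourier_neg g, neg_neg]
  rw [← integral_fourier_mul_eq_of_integrable hf' hg, Real.fourierInv_eq_fourier_comp_neg]

/-- This is `(-Δ - z)⁻¹ = ∫ ζ exp (ζ z τ) exp (ζ τ Δ) dτ` over `τ > 0`. The condition `Re ζ > 0`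
makes the heat multipliers Gaussian, and `Re (ζ z) < 0` makes the integral converge and supplies the
majorant for Fubini. -/
theorem integral_mul_schwartzResolvent {z ζ : ℂ} (hz : z.im ≠ 0) (hζ : 0 < ζ.re)
    (hc : (ζ * z).re < 0) {f : V → ℂ} (hf : Integrable f) (ψ : 𝓢(V, ℂ)) :
    ∫ x, f x * schwartzResolvent z ψ x = ∫ τ in Set.Ioi (0 : ℝ), ζ * Complex.exp (ζ * z * τ) *
      ∫ ξ, Complex.exp (-(ζ * τ * (2 * Real.pi) ^ 2) * ‖ξ‖ ^ 2) * (𝓕⁻ f ξ * 𝓕 (ψ : V → ℂ) ξ) := by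
  have hζ0 : ζ ≠ 0 := by rintro rfl; simp at hζ
  have hψ : Integrable (𝓕 (ψ : V → ℂ)) := by
    rw [← SchwartzMap.fourier_coe]; exact SchwartzMap.integrable _
  have hsym : Integrable (fun ξ => resolventSymbol z ξ * 𝓕 (ψ : V → ℂ) ξ) := by
    refine hψ.bdd_mul (c := |z.im|⁻¹)
      (hasTemperateGrowth_resolventSymbol hz).1.continuous.aestronglyMeasurable
      (.of_forall fun ξ => ?_)
    rw [resolventSymbol, norm_inv]
    refine inv_anti₀ (abs_pos.2 hz) ?_
    simpa [-Complex.ofReal_mul, -Complex.ofReal_pow] using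
      Complex.abs_im_le_norm ((((2 * Real.pi) ^ 2 * ‖ξ‖ ^ 2 : ℝ) : ℂ) - z)
  set a : V → ℂ := fun ξ => ζ * z - ((2 * Real.pi) ^ 2 * ‖ξ‖ ^ 2 : ℝ) * ζ with ha
  have hare : ∀ ξ, (a ξ).re ≤ (ζ * z).re := fun ξ => by
    simp only [ha, Complex.sub_re, Complex.re_ofReal_mul]
    have : 0 ≤ (2 * Real.pi) ^ 2 * ‖ξ‖ ^ 2 * ζ.re := by positivity
    linarith
  have hsymb : ∀ ξ, resolventSymbol z ξ = ∫ τ in Set.Ioi (0 : ℝ), ζ * Complex.exp (a ξ * τ) := by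
    intro ξ
    rw [integral_const_mul, integral_exp_mul_complex_Ioi ((hare ξ).trans_lt hc)]
    have h1 := ofReal_sub_ne_zero hz ((2 * Real.pi) ^ 2 * ‖ξ‖ ^ 2)
    have h2 : a ξ = -(ζ * (((2 * Real.pi) ^ 2 * ‖ξ‖ ^ 2 : ℝ) - z)) := by rw [ha]; ring
    rw [h2, resolventSymbol]
    simp only [Complex.ofReal_zero, mul_zero, Complex.exp_zero]
    field_simp
  have hint : Integrable (Function.uncurry fun (ξ : V) (τ : ℝ) =>
      ζ * Complex.exp (a ξ * τ) * (𝓕⁻ f ξ * 𝓕 (ψ : V → ℂ) ξ))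
      (volume.prod (volume.restrict (Set.Ioi (0 : ℝ)))) := by
    have h1 : Integrable (fun p : V × ℝ => (𝓕 (ψ : V → ℂ) p.1) * Real.exp ((ζ * z).re * p.2))
        (volume.prod (volume.restrict (Set.Ioi (0 : ℝ)))) :=
      hψ.mul_prod (integrableOn_exp_mul_Ioi hc 0).ofReal
    refine (h1.norm.const_mul (‖ζ‖ * ∫ x, ‖f x‖)).mono' ?_ ?_
    · have c1 : Continuous a := by rw [ha]; fun_prop
      have c2 := continuous_fourierInv_of_integrable hf
      have c3 := continuous_fourier_of_integrable (V := V) ψ.integrable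
      have : Continuous (Function.uncurry fun (ξ : V) (τ : ℝ) =>
        ζ * Complex.exp (a ξ * τ) * (𝓕⁻ f ξ * 𝓕 (ψ : V → ℂ) ξ)) := by
        unfold Function.uncurry; fun_prop
      exact this.aestronglyMeasurable
    · have hpos : ∀ᵐ p : V × ℝ ∂(volume.prod (volume.restrict (Set.Ioi (0 : ℝ)))), 0 < p.2 :=
        Measure.quasiMeasurePreserving_snd.ae (ae_restrict_mem measurableSet_Ioi)
      filter_upwards [hpos] with p hp
      simp only [Function.uncurry, norm_mul, Complex.norm_exp, Complex.re_mul_ofReal,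
        Complex.norm_real, Real.norm_eq_abs, Real.abs_exp]
      have e1 : Real.exp ((a p.1).re * p.2) ≤ Real.exp ((ζ * z).re * p.2) :=
        Real.exp_le_exp.2 (mul_le_mul_of_nonneg_right (hare _) hp.le)
      calc _ ≤ ‖ζ‖ * Real.exp ((ζ * z).re * p.2) * ((∫ x, ‖f x‖) * ‖𝓕 (ψ : V → ℂ) p.1‖) := by
            have := norm_fourierInv_le_integral_norm f p.1
            gcongr
        _ = _ := by ring
  calc _ = ∫ ξ, 𝓕⁻ f ξ * (resolventSymbol z ξ * 𝓕 (ψ : V → ℂ) ξ) := by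
        simp_rw [schwartzResolvent_apply hz]
        exact integral_mul_fourierInv_eq hf hsym
    _ = ∫ ξ, ∫ τ in Set.Ioi (0 : ℝ), ζ * Complex.exp (a ξ * τ) *
        (𝓕⁻ f ξ * 𝓕 (ψ : V → ℂ) ξ) := by
      congr 1; ext ξ
      rw [integral_mul_const, ← hsymb]
      ring
    _ = _ := by
      rw [integral_integral_swap hint]
      congr 1; ext τ
      rw [← integral_const_mul]
      congr 1; ext ξ
      have : Complex.exp (a ξ * τ) = Complex.exp (ζ * z * τ) *
          Complex.exp (-(ζ * τ * (2 * Real.pi) ^ 2) * ‖ξ‖ ^ 2) := by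
        rw [← Complex.exp_add, ha]
        congr 1
        push_cast; ring
      rw [this]; ring

/-- By the choice of `α` the heat bound is `(4πτ)^(α-1)`, so what remains is Euler's integral for
`Γ(α)`, convergent at zero because `α > 0`. -/
theorem norm_integral_mul_schwartzResolvent_le_aux {z ζ : ℂ} (hz : z.im ≠ 0) (hζ : 0 < ζ.re)
    (hζ1 : 1 ≤ ‖ζ‖) (hc : (ζ * z).re < 0) {q : ℝ≥0∞} (hq1 : 1 ≤ q) (hq2 : q ≤ 2) {α : ℝ}
    (hα : α = 1 - Module.finrank ℝ V / 2 * (2 / q.toReal - 1)) (hα0 : 0 < α)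
    {f : V → ℂ} (hf : Integrable f) (hfq : MemLp f q) (ψ : 𝓢(V, ℂ)) :
    ‖∫ x, f x * schwartzResolvent z ψ x‖ ≤ ‖ζ‖ * ((4 * Real.pi) ^ (α - 1) *
      ((-(ζ * z).re)⁻¹ ^ α * Real.Gamma α)) * ((eLpNorm f q).toReal * (eLpNorm ψ q).toReal) := by
  rw [integral_mul_schwartzResolvent hz hζ hc hf]
  set N := (eLpNorm f q).toReal * (eLpNorm ψ q).toReal
  have hc' : 0 < -(ζ * z).re := by linarith
  have hG := Real.integral_rpow_mul_exp_neg_mul_Ioi hα0 hc'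
  have hGpos : 0 < (1 / -(ζ * z).re) ^ α * Real.Gamma α := by
    have := Real.Gamma_pos_of_pos hα0
    positivity
  have hGi : IntegrableOn (fun t : ℝ => t ^ (α - 1) * Real.exp (-(-(ζ * z).re * t)))
      (Set.Ioi 0) := not_imp_comm.1 integral_undef (by rw [hG]; exact hGpos.ne')
  calc _ ≤ ∫ τ in Set.Ioi (0 : ℝ), (‖ζ‖ * (4 * Real.pi) ^ (α - 1) * N) *
        (τ ^ (α - 1) * Real.exp (-(-(ζ * z).re * τ))) := by
        refine norm_integral_le_of_norm_le (hGi.const_mul _)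
          ((ae_restrict_mem measurableSet_Ioi).mono fun τ hτ => ?_)
        have hτ' : 0 < τ := hτ
        have h1 := norm_heat_form_le hζ hζ1 hτ' hq1 hq2 hf ψ.integrable hfq (ψ.memLp q)
        have h2 : (-(Module.finrank ℝ V / 2 * (2 / q.toReal - 1)) : ℝ) = α - 1 := by rw [hα]; ring
        rw [h2, Real.mul_rpow (by positivity) hτ'.le] at h1
        rw [norm_mul, norm_mul, Complex.norm_exp, Complex.re_mul_ofReal]
        calc _ ≤ ‖ζ‖ * Real.exp ((ζ * z).re * τ) * ((4 * Real.pi) ^ (α - 1) * τ ^ (α - 1) * N) := by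
              gcongr
          _ = _ := by rw [neg_mul, neg_neg]; ring
    _ = _ := by
      rw [integral_const_mul, hG, one_div]
      ring

theorem norm_integral_mul_schwartzResolvent_le_of_integrable {z : ℂ} (hz : z.im ≠ 0)
    {q : ℝ≥0∞} (hq1 : 1 ≤ q) (hq2 : q ≤ 2) {α : ℝ}
    (hα : α = 1 - Module.finrank ℝ V / 2 * (2 / q.toReal - 1)) (hα0 : 0 < α)
    {f : V → ℂ} (hf : Integrable f) (hfq : MemLp f q) (ψ : 𝓢(V, ℂ)) :
    ‖∫ x, f x * schwartzResolvent z ψ x‖ ≤ (4 * Real.pi) ^ (α - 1) *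
      (|z.im|⁻¹ ^ α * Real.Gamma α) * ((eLpNorm f q).toReal * (eLpNorm ψ q).toReal) := by
  have hzp : 0 < |z.im| := abs_pos.2 hz
  set s : ℝ := ((SignType.sign z.im : SignType) : ℝ) with hs
  have hs1 : s * z.im = |z.im| := sign_mul_self z.im
  have hs2 : |s| = 1 := by
    have := congrArg abs hs1
    rw [abs_mul, abs_abs] at this
    exact mul_right_cancel₀ hzp.ne' (by linarith)
  -- The optimal ray `ζ = i sgn (Im z)` gives decay rate exactly `|Im z|` but has `Re ζ = 0`. It is
  -- approached by `ε + i sgn (Im z)`, of modulus at least one, and the bound is continuous as `ε →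
  -- 0`.
  set ζ : ℝ → ℂ := fun ε => ⟨ε, s⟩ with hζ
  have hre : ∀ ε, -(ζ ε * z).re = |z.im| - ε * z.re := fun ε => by
    rw [Complex.mul_re, ← hs1]; ring
  have hζc : Continuous fun ε => ‖ζ ε‖ := by
    have : ζ = fun ε : ℝ => (ε : ℂ) + s * Complex.I := by
      ext ε
      simp [hζ, Complex.mk_eq_add_mul_I]
    rw [this]; fun_prop
  have hζ0 : ‖ζ 0‖ = 1 := by
    have : ζ 0 = s * Complex.I := by simp [hζ, Complex.mk_eq_add_mul_I]
    rw [this]; simp [hs2]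
  have hlim : Filter.Tendsto (fun ε : ℝ => ‖ζ ε‖ * ((4 * Real.pi) ^ (α - 1) *
      ((|z.im| - ε * z.re)⁻¹ ^ α * Real.Gamma α)) * ((eLpNorm f q).toReal * (eLpNorm ψ q).toReal))
      (nhdsWithin 0 (Set.Ioi 0)) (nhds (1 * ((4 * Real.pi) ^ (α - 1) *
      (|z.im|⁻¹ ^ α * Real.Gamma α)) * ((eLpNorm f q).toReal * (eLpNorm ψ q).toReal))) := by
    have h1 : Filter.Tendsto (fun ε : ℝ => ‖ζ ε‖) (nhdsWithin 0 (Set.Ioi 0)) (nhds 1) := by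
      rw [← hζ0]; exact (hζc.tendsto 0).mono_left nhdsWithin_le_nhds
    have h2 : Filter.Tendsto (fun ε : ℝ => |z.im| - ε * z.re) (nhdsWithin 0 (Set.Ioi 0))
        (nhds |z.im|) := by
      have : Continuous fun ε : ℝ => |z.im| - ε * z.re := by fun_prop
      simpa using (this.tendsto 0).mono_left (nhdsWithin_le_nhds (s := Set.Ioi 0))
    exact (h1.mul ((((h2.inv₀ hzp.ne').rpow_const (Or.inr hα0.le)).mul_const _).const_mul _)).mul_const _
  rw [one_mul] at hlim
  refine ge_of_tendsto hlim ?_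
  have hev : ∀ᶠ ε : ℝ in nhdsWithin 0 (Set.Ioi 0), 0 < |z.im| - ε * z.re := by
    have : Continuous fun ε : ℝ => |z.im| - ε * z.re := by fun_prop
    exact nhdsWithin_le_nhds (continuous_const.continuousAt.eventually_lt this.continuousAt (by simpa using hz))
  filter_upwards [hev, self_mem_nhdsWithin] with ε h1 h2
  rw [← hre]
  refine norm_integral_mul_schwartzResolvent_le_aux (ζ := ζ ε) hz h2 ?_ (by linarith [hre ε]) hq1 hq2 hα hα0 hf
    hfq ψ
  calc 1 = |(ζ ε).im| := hs2.symm
    _ ≤ ‖ζ ε‖ := Complex.abs_im_le_norm _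

theorem norm_integral_mul_schwartzResolvent_le {z : ℂ} (hz : z.im ≠ 0)
    {q : ℝ≥0∞} (hq1 : 1 ≤ q) (hq2 : q ≤ 2) {α : ℝ}
    (hα : α = 1 - Module.finrank ℝ V / 2 * (2 / q.toReal - 1)) (hα0 : 0 < α)
    {f : V → ℂ} (hfq : MemLp f q) (ψ : 𝓢(V, ℂ)) :
    ‖∫ x, f x * schwartzResolvent z ψ x‖ ≤ (4 * Real.pi) ^ (α - 1) *
      (|z.im|⁻¹ ^ α * Real.Gamma α) * ((eLpNorm f q).toReal * (eLpNorm ψ q).toReal) := by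
  have hqt : q ≠ ⊤ := (hq2.trans_lt (by simp)).ne
  have hq0 : q ≠ 0 := (zero_lt_one.trans_le hq1).ne'
  have : ENNReal.HolderConjugate q (ENNReal.conjExponent q) :=
    ENNReal.HolderConjugate.conjExponent hq1
  have hΓ := Real.Gamma_pos_of_pos hα0
  have h := norm_integral_mul_le_of_simpleFunc hq1 hqt
    ((schwartzResolvent z ψ).memLp (ENNReal.conjExponent q))
    (C := (4 * Real.pi) ^ (α - 1) * (|z.im|⁻¹ ^ α * Real.Gamma α) * (eLpNorm ψ q).toReal)
    (by positivity) (fun g hg => ?_) hfq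
  · refine h.trans (le_of_eq ?_); ring
  · have hgi : Integrable g := SimpleFunc.integrable_iff_finMeasSupp.2
      ((SimpleFunc.memLp_iff_finMeasSupp hq0 hqt).1 hg)
    refine (norm_integral_mul_schwartzResolvent_le_of_integrable hz hq1 hq2 hα hα0 hgi hg ψ).trans
      (le_of_eq ?_)
    ring

end Resolvent

/-! ### From compactly supported to Schwartz test functions. -/

section SchwartzTest

open scoped SchwartzMap

/-- The induction absorbs one derivative into the target space, hence the quantification over `F`
after `j`. -/
theorem memLp_norm_iteratedFDeriv_schwartz {n : ℕ} (j : ℕ) :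
    ∀ {F : Type} [NormedAddCommGroup F] [NormedSpace ℝ F]
      (φ : 𝓢(EuclideanSpace ℝ (Fin n), F)) (p : ℝ≥0∞),
      MemLp (fun x => ‖iteratedFDeriv ℝ j φ x‖) p := by
  induction j with
  | zero =>
    intro F _ _ φ p
    simpa using (φ.memLp p).norm
  | succ j ih =>
    intro F _ _ φ p
    refine (ih (SchwartzMap.fderivCLM ℝ _ F φ) p).congr_norm ?_ (.of_forall fun x => ?_)
    · exact (φ.smooth (j + 1 : ℕ∞)).continuous_iteratedFDeriv'.norm.aestronglyMeasurable
    · rw [norm_norm, norm_norm, ← norm_iteratedFDeriv_fderiv]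
      rfl

theorem norm_laplacian_le {n : ℕ} (f : EuclideanSpace ℝ (Fin n) → ℂ)
    (x : EuclideanSpace ℝ (Fin n)) :
    ‖Laplacian.laplacian f x‖ ≤ n * ‖iteratedFDeriv ℝ 2 f x‖ := by
  rw [InnerProductSpace.laplacian_eq_iteratedFDeriv_orthonormalBasis f
    (EuclideanSpace.basisFun (Fin n) ℝ)]
  refine (norm_sum_le _ _).trans ?_
  calc _ ≤ ∑ _i : Fin n, ‖iteratedFDeriv ℝ 2 f x‖ := by
        refine Finset.sum_le_sum fun i _ => ?_
        refine (ContinuousMultilinearMap.le_opNorm _ _).trans (le_of_eq ?_)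
        simp [Fin.prod_univ_two]
    _ = _ := by simp

/-- Schwartz functions are admissible test functions when all terms are in Lebesgue spaces. -/
theorem WeakEq.eq_of_schwartz {n : ℕ} {u v f : EuclideanSpace ℝ (Fin n) → ℂ} (h : WeakEq u v f)
    {p₁ p₂ p₃ : ℝ≥0∞} (hp₁ : 1 ≤ p₁) (hp₂ : 1 ≤ p₂) (hp₃ : 1 ≤ p₃)
    (hu : MemLp u p₁) (hv : MemLp v p₂) (hf : MemLp f p₃)
    (φ : 𝓢(EuclideanSpace ℝ (Fin n), ℂ)) :
    (∫ x, u x * -(Laplacian.laplacian (φ : EuclideanSpace ℝ (Fin n) → ℂ) x)) + (∫ x, v x * φ x) = ∫ x, f x * φ x := by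
  let χ₀ : ContDiffBump (0 : EuclideanSpace ℝ (Fin n)) := ⟨1, 2, one_pos, one_lt_two⟩
  set χ : EuclideanSpace ℝ (Fin n) → ℂ := fun x => (χ₀ x : ℂ) with hχ
  have hχs : ContDiff ℝ ∞ χ := Complex.ofRealCLM.contDiff.comp χ₀.contDiff
  have hχc : HasCompactSupport χ := χ₀.hasCompactSupport.comp_left (g := Complex.ofReal) rfl
  have hχ1 : ∀ x, ‖χ x‖ ≤ 1 := fun x => by
    rw [hχ, Complex.norm_real, Real.norm_of_nonneg χ₀.nonneg]; exact χ₀.le_one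
  -- The cutoffs are `χ (x / (k + 1))`. Scales at most one keep each order of derivative bounded
  -- uniformly in `k`.
  set c : ℕ → ℝ := fun k => ((k : ℝ) + 1)⁻¹ with hc
  have hc0 : ∀ k, 0 < c k := fun k => by simp only [hc]; positivity
  have hc1 : ∀ k, c k ≤ 1 := fun k => inv_le_one_of_one_le₀ (by simp)
  set X : ℕ → EuclideanSpace ℝ (Fin n) → ℂ := fun k x => χ (c k • x) with hX
  have hXs : ∀ k, ContDiff ℝ ∞ (X k) := fun k => hχs.comp (contDiff_const_smul _)
  have hXc : ∀ k, HasCompactSupport (X k) := fun k => hχc.comp_smul (hc0 k).ne'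
  have hXd : ∀ i : ℕ, ∃ C, ∀ k x, ‖iteratedFDeriv ℝ i (X k) x‖ ≤ C := by
    intro i
    refine ⟨SchwartzMap.seminorm ℝ 0 i (hχc.toSchwartzMap hχs), fun k x => ?_⟩
    have e : iteratedFDeriv ℝ i (X k) x = c k ^ i • iteratedFDeriv ℝ i χ (c k • x) :=
      congrFun (iteratedFDeriv_comp_const_smul (c k) (hχs.of_le (by exact_mod_cast le_top))) x
    rw [e, norm_smul, norm_pow, Real.norm_of_nonneg (hc0 k).le]
    refine (mul_le_of_le_one_left (norm_nonneg _) (pow_le_one₀ (hc0 k).le (hc1 k))).trans ?_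
    exact SchwartzMap.norm_iteratedFDeriv_le_seminorm ℝ (hχc.toSchwartzMap hχs) i (c k • x)
  choose C hC using hXd
  -- Equality to one on a neighbourhood, not only at `x`, is needed for the Laplacians to agree at
  -- `x`.
  have hev : ∀ x, ∀ᶠ k in Filter.atTop, ∀ᶠ y in nhds x, X k y = 1 := by
    intro x
    obtain ⟨N, hN⟩ := exists_nat_gt ‖x‖
    filter_upwards [Filter.eventually_ge_atTop N] with k hk
    have hlt : ‖x‖ < (k : ℝ) + 1 := by
      have : (N : ℝ) ≤ k := by exact_mod_cast hk
      linarith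
    filter_upwards [continuous_norm.continuousAt.eventually_lt continuousAt_const hlt] with y hy
    have hmem : c k • y ∈ Metric.closedBall (0 : EuclideanSpace ℝ (Fin n)) χ₀.rIn := by
      rw [mem_closedBall_zero_iff, norm_smul, Real.norm_of_nonneg (hc0 k).le]
      change ((k : ℝ) + 1)⁻¹ * ‖y‖ ≤ 1
      rw [inv_mul_le_iff₀ (by positivity)]
      linarith
    simp only [hX, hχ]
    rw [χ₀.one_of_mem_closedBall hmem, Complex.ofReal_one]
  have hφs := φ.smooth ⊤
  have htest : ∀ k, IsTestFunction (fun x => X k x * φ x) := fun k =>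
    ⟨(hXs k).mul hφs, (hXc k).mul_right⟩
  have conv0 : ∀ {w : EuclideanSpace ℝ (Fin n) → ℂ} {q : ℝ≥0∞}, 1 ≤ q → MemLp w q →
      Filter.Tendsto (fun k => ∫ x, w x * (X k x * φ x)) Filter.atTop (nhds (∫ x, w x * φ x)) := by
    intro w q hq hw
    have : ENNReal.HolderConjugate q (ENNReal.conjExponent q) :=
      ENNReal.HolderConjugate.conjExponent hq
    have hi : Integrable fun x => w x * φ x :=
      MemLp.integrable_mul hw (φ.memLp (ENNReal.conjExponent q))
    refine tendsto_integral_of_dominated_convergence (fun x => ‖w x * φ x‖) (fun k => ?_) hi.norm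
      (fun k => .of_forall fun x => ?_) (.of_forall fun x => ?_)
    · exact hw.1.mul (htest k).1.continuous.aestronglyMeasurable
    · rw [norm_mul, norm_mul, norm_mul]
      have := hχ1 (c k • x)
      exact mul_le_mul_of_nonneg_left (mul_le_of_le_one_left (norm_nonneg _) this) (norm_nonneg _)
    · refine tendsto_const_nhds.congr' ?_
      filter_upwards [hev x] with k hk
      rw [hk.self_of_nhds, one_mul]
  have conv2 : Filter.Tendsto (fun k => ∫ x, u x * -(Laplacian.laplacian (fun x => X k x * φ x) x))
      Filter.atTop (nhds (∫ x, u x * -(Laplacian.laplacian (φ : EuclideanSpace ℝ (Fin n) → ℂ) x))) := by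
    have : ENNReal.HolderConjugate p₁ (ENNReal.conjExponent p₁) :=
      ENNReal.HolderConjugate.conjExponent hp₁
    -- The majorant is the Leibniz bound for the second derivative of the cut-off function; the
    -- factor `n` comes from the trace.
    set G : EuclideanSpace ℝ (Fin n) → ℝ := fun x => ∑ i ∈ Finset.range 3,
      n * ((Nat.choose 2 i : ℝ) * C i) * ‖iteratedFDeriv ℝ (2 - i) φ x‖ with hG
    have hGm : MemLp G (ENNReal.conjExponent p₁) := memLp_finsetSum _ fun i _ =>
      (memLp_norm_iteratedFDeriv_schwartz (2 - i) φ _).const_mul _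
    have hi : Integrable fun x => ‖u x‖ * G x := MemLp.integrable_mul hu.norm hGm
    refine tendsto_integral_of_dominated_convergence (fun x => ‖u x‖ * G x) (fun k => ?_) hi
      (fun k => .of_forall fun x => ?_) (.of_forall fun x => ?_)
    · exact hu.1.mul (htest k).continuous_laplacian.aestronglyMeasurable
    · rw [norm_mul, norm_neg]
      refine mul_le_mul_of_nonneg_left ((norm_laplacian_le _ x).trans ?_) (norm_nonneg _)
      rw [hG]
      simp only [mul_assoc]
      rw [← Finset.mul_sum]
      refine mul_le_mul_of_nonneg_left ?_ (Nat.cast_nonneg n)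
      refine (norm_iteratedFDeriv_mul_le (N := ((2 : ℕ) : ℕ∞ω)) ((hXs k).of_le (by norm_cast))
        (hφs.of_le (by norm_cast)) x le_rfl).trans (Finset.sum_le_sum fun i _ => ?_)
      rw [mul_assoc]
      gcongr
      exact hC i k x
    · refine tendsto_const_nhds.congr' ?_
      filter_upwards [hev x] with k hk
      have : (fun x => X k x * φ x) =ᶠ[nhds x] φ := by
        filter_upwards [hk] with y hy
        rw [hy, one_mul]
      rw [(InnerProductSpace.laplacian_congr_nhds this).self_of_nhds]
  refine tendsto_nhds_unique (conv2.add (conv0 hp₂ hv)) ((conv0 hp₃ hf).congr fun k => ?_)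
  exact (h _ (htest k)).symm

end SchwartzTest

theorem eLpNorm_mul_le_mul_eLpNorm {α : Type*} [MeasurableSpace α] {μ : Measure α} {f g : α → ℂ}
    {p q r : ℝ≥0∞} [ENNReal.HolderTriple p q r] (hf : AEStronglyMeasurable f μ)
    (hg : AEStronglyMeasurable g μ) :
    eLpNorm (fun x => f x * g x) r μ ≤ eLpNorm f p μ * eLpNorm g q μ := by
  have h : eLpNorm (f • g) r μ ≤ eLpNorm f p μ * eLpNorm g q μ := eLpNorm_smul_le_mul_eLpNorm hg hf
  exact h

/-! ### Eigenfunctions through the resolvent, and duality. -/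

section EigenfunctionEstimate

open scoped SchwartzMap

variable {n : ℕ}

/-- The equation is tested with `(-Δ - z)⁻¹ ψ`; the two terms carrying `z` cancel. -/
theorem integral_mul_eq_neg_schwartzResolvent {u w : EuclideanSpace ℝ (Fin n) → ℂ} {z : ℂ}
    (hz : z.im ≠ 0) (h : WeakEq u w (z • u)) {p q : ℝ≥0∞} (hp : 1 ≤ p) (hq : 1 ≤ q)
    (hu : MemLp u p) (hw : MemLp w q) (ψ : 𝓢(EuclideanSpace ℝ (Fin n), ℂ)) :
    ∫ x, u x * ψ x = -∫ x, w x * schwartzResolvent z ψ x := by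
  have : ENNReal.HolderConjugate p (ENNReal.conjExponent p) :=
    ENNReal.HolderConjugate.conjExponent hp
  have hi : ∀ φ : 𝓢(EuclideanSpace ℝ (Fin n), ℂ), Integrable fun x => u x * φ x := fun φ =>
    MemLp.integrable_mul hu (φ.memLp (ENNReal.conjExponent p))
  have h1 := h.eq_of_schwartz hp hq hp hu hw (hu.const_smul z) (schwartzResolvent z ψ)
  simp_rw [laplacian_schwartzResolvent hz, mul_add] at h1
  have h2 : ∀ x, u x * (z * schwartzResolvent z ψ x) = z * (u x * schwartzResolvent z ψ x) :=
    fun x => by ring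
  simp_rw [h2, Pi.smul_apply, smul_eq_mul, mul_assoc] at h1
  rw [integral_add (hi ψ) ((hi _).const_mul z)] at h1
  linear_combination h1

/-- An estimate for the pairing with smooth compactly supported functions extends to functions of
bounded support in the dual Lebesgue space. -/
theorem norm_integral_mul_le_of_schwartz {u : EuclideanSpace ℝ (Fin n) → ℂ} {p p' q s : ℝ≥0∞}
    [ENNReal.HolderConjugate p p'] [ENNReal.HolderTriple s p' q] (hp' : p' ≠ ⊤) (hp'1 : 1 ≤ p')
    (hq : 1 ≤ q) (hu : MemLp u p) {K : ℝ} (hK : 0 ≤ K)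
    (hψ : ∀ ψ : 𝓢(EuclideanSpace ℝ (Fin n), ℂ), ‖∫ x, u x * ψ x‖ ≤ K * (eLpNorm ψ q).toReal)
    {g : EuclideanSpace ℝ (Fin n) → ℂ} (hg : MemLp g p') {R : ℝ} (hR : 0 < R)
    (hgR : ∀ x, R < ‖x‖ → g x = 0) :
    MemLp g q ∧ ‖∫ x, u x * g x‖ ≤ K * (eLpNorm g q).toReal := by
  let χ₀ : ContDiffBump (0 : EuclideanSpace ℝ (Fin n)) := ⟨R, R + 1, hR, by linarith⟩
  set χ : EuclideanSpace ℝ (Fin n) → ℂ := fun x => (χ₀ x : ℂ) with hχ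
  have hχs : ContDiff ℝ ∞ χ := Complex.ofRealCLM.contDiff.comp χ₀.contDiff
  have hχc : HasCompactSupport χ := χ₀.hasCompactSupport.comp_left (g := Complex.ofReal) rfl
  have hχ1 : ∀ x, ‖χ x‖ ≤ 1 := fun x => by
    rw [hχ, Complex.norm_real, Real.norm_of_nonneg χ₀.nonneg]; exact χ₀.le_one
  have hχL : MemLp χ s := hχs.continuous.memLp_of_hasCompactSupport hχc
  -- Since the cutoff reproduces `g`, Hölder with `χ ∈ L_s` turns an `L_{p'}` approximation of `g`
  -- into an `L_q` one. Thus `χ ψ₀` is close to `g` in both norms at once.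
  have hχg : χ * g = g := by
    ext x
    by_cases hx : R < ‖x‖
    · simp [hgR x hx]
    · have : χ₀ x = 1 := χ₀.one_of_mem_closedBall (by
        rw [mem_closedBall_zero_iff]; exact not_lt.1 hx)
      simp [hχ, this]
  have hgq : MemLp g q := by
    have := MemLp.mul hg hχL (r := q)
    rwa [hχg] at this
  refine ⟨hgq, ?_⟩
  have happ : ∀ δ : ℝ, 0 < δ → ‖∫ x, u x * g x‖ ≤
      K * ((eLpNorm g q).toReal + (eLpNorm χ s).toReal * δ) + (eLpNorm u p).toReal * δ := by
    intro δ hδ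
    obtain ⟨ψ₀, hc, hs, hd⟩ := hg.exist_eLpNorm_sub_le hp' hp'1 hδ
    have hψ₀ : MemLp ψ₀ p' := hs.continuous.memLp_of_hasCompactSupport hc
    have hs' : ContDiff ℝ ∞ (χ * ψ₀) := hχs.mul hs
    have hc' : HasCompactSupport (χ * ψ₀) := hc.mul_left
    have hψ1 : ‖∫ x, u x * (χ * ψ₀) x‖ ≤ K * (eLpNorm (χ * ψ₀) q).toReal :=
      hψ (hc'.toSchwartzMap hs')
    have hm : MemLp (χ * ψ₀) q := hs'.continuous.memLp_of_hasCompactSupport hc'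
    have hm' : MemLp (χ * ψ₀) p' := hs'.continuous.memLp_of_hasCompactSupport hc'
    have hdiff : g - χ * ψ₀ = χ * (g - ψ₀) := by rw [mul_sub, hχg]
    have hb1 : (eLpNorm (g - χ * ψ₀) q).toReal ≤ (eLpNorm χ s).toReal * δ := by
      rw [← ENNReal.toReal_ofReal hδ.le, ← ENNReal.toReal_mul]
      refine ENNReal.toReal_mono (ENNReal.mul_ne_top hχL.2.ne ENNReal.ofReal_ne_top) ?_
      rw [hdiff]
      exact (eLpNorm_mul_le_mul_eLpNorm (p := s) (q := p') hχL.1 (hg.sub hψ₀).1).trans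
        (mul_le_mul_right hd _)
    have hb2 : (eLpNorm (g - χ * ψ₀) p').toReal ≤ δ := by
      refine ENNReal.toReal_le_of_le_ofReal hδ.le (le_trans ?_ hd)
      rw [hdiff]
      refine eLpNorm_mono fun x => ?_
      rw [Pi.mul_apply, norm_mul]
      exact mul_le_of_le_one_left (norm_nonneg _) (hχ1 x)
    have hb3 : (eLpNorm (χ * ψ₀) q).toReal ≤
        (eLpNorm g q).toReal + (eLpNorm χ s).toReal * δ := by
      have := toReal_eLpNorm_le_add hq hgq hm
      linarith
    have i1 : Integrable fun x => u x * (χ * ψ₀) x := MemLp.integrable_mul hu hm'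
    have i2 : Integrable fun x => u x * (g - χ * ψ₀) x := MemLp.integrable_mul hu (hg.sub hm')
    have hsum : ∫ x, u x * g x = (∫ x, u x * (χ * ψ₀) x) + ∫ x, u x * (g - χ * ψ₀) x := by
      rw [← integral_add i1 i2]
      congr 1; ext x
      simp only [Pi.sub_apply]; ring
    rw [hsum]
    refine (norm_add_le _ _).trans (add_le_add (hψ1.trans ?_)
      ((norm_integral_mul_le_eLpNorm_mul_eLpNorm hu (hg.sub hm')).trans ?_))
    · gcongr
    · gcongr
  have hlim : Filter.Tendsto (fun δ : ℝ => K * ((eLpNorm g q).toReal + (eLpNorm χ s).toReal * δ) +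
      (eLpNorm u p).toReal * δ) (nhdsWithin 0 (Set.Ioi 0)) (nhds (K * (eLpNorm g q).toReal)) := by
    have : Continuous (fun δ : ℝ => K * ((eLpNorm g q).toReal + (eLpNorm χ s).toReal * δ) +
      (eLpNorm u p).toReal * δ) := by fun_prop
    simpa using (this.tendsto 0).mono_left (nhdsWithin_le_nhds (s := Set.Ioi 0))
  refine ge_of_tendsto hlim ?_
  filter_upwards [self_mem_nhdsWithin] with δ hδ using happ δ hδ

/-- Duality: a bound for the pairing of `u` with functions of bounded support in `L_q` controls the
norm of `b u` in `L_p`. -/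
theorem eLpNorm_mul_le_of_pairing {u b : EuclideanSpace ℝ (Fin n) → ℂ} {p p' q s : ℝ≥0∞}
    [ENNReal.HolderConjugate p p'] [ENNReal.HolderTriple s p' q] (hp1 : 1 < p) (hp : p ≠ ⊤)
    (hb : MemLp b s) (hv : MemLp (fun x => b x * u x) p) {K : ℝ} (hK : 0 ≤ K)
    (h : ∀ g : EuclideanSpace ℝ (Fin n) → ℂ, MemLp g p' → ∀ R : ℝ, 0 < R →
      (∀ x, R < ‖x‖ → g x = 0) → ‖∫ x, u x * g x‖ ≤ K * (eLpNorm g q).toReal) :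
    (eLpNorm (fun x => b x * u x) p).toReal ≤ K * (eLpNorm b s).toReal := by
  have hp0 : p ≠ 0 := (zero_lt_one.trans hp1).ne'
  have hpr : 1 < p.toReal := by
    simpa using (ENNReal.toReal_lt_toReal ENNReal.one_ne_top hp).2 hp1
  have hp't : p' ≠ ⊤ := by
    rintro rfl
    have := ENNReal.HolderConjugate.inv_add_inv_eq_one p ⊤
    simp at this
    exact hp1.ne' this
  have hp'0 : p' ≠ 0 := ENNReal.HolderConjugate.ne_zero p' p
  have hinv : p.toReal⁻¹ + p'.toReal⁻¹ = 1 := by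
    have h1 := congrArg ENNReal.toReal (ENNReal.HolderConjugate.inv_add_inv_eq_one p p')
    rwa [ENNReal.toReal_add (ENNReal.inv_ne_top.2 hp0) (ENNReal.inv_ne_top.2 hp'0),
      ENNReal.toReal_inv, ENNReal.toReal_inv, ENNReal.toReal_one] at h1
  have hp'r : 0 < p'.toReal := ENNReal.toReal_pos hp'0 hp't
  have hconj : (p.toReal - 1) * p'.toReal = p.toReal := by
    field_simp at hinv
    linarith
  set P := p.toReal
  set P' := p'.toReal
  set v : EuclideanSpace ℝ (Fin n) → ℂ := fun x => b x * u x with hvdef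
  -- On `E k` both `x` and `b` are bounded, so `b` times a truncated `L_{p'}` function is still in
  -- `L_{p'}`, with bounded support.
  set E : ℕ → Set (EuclideanSpace ℝ (Fin n)) := fun k => {x | ‖x‖ ≤ (k : ℝ) + 1 ∧ ‖b x‖ ≤ k} with hE
  have hEm : ∀ k, NullMeasurableSet (E k) := fun k =>
    (measurableSet_le measurable_norm measurable_const).nullMeasurableSet.inter
      (nullMeasurableSet_le hb.1.norm.aemeasurable aemeasurable_const)
  -- The Hölder extremal for `v`: it satisfies `v η = |v|^P = |η|^P'`.
  set η : EuclideanSpace ℝ (Fin n) → ℂ :=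
    fun x => ((‖v x‖ ^ (P - 2) : ℝ) : ℂ) * starRingEnd ℂ (v x) with hη
  have hηn : ∀ x, ‖η x‖ = ‖v x‖ ^ (P - 1) := fun x => by
    by_cases h0 : ‖v x‖ = 0
    · rw [hη]
      simp only [norm_mul, RCLike.norm_conj, h0, mul_zero]
      rw [Real.zero_rpow (by linarith)]
    · rw [hη]
      simp only [norm_mul, RCLike.norm_conj, Complex.norm_real]
      rw [Real.norm_of_nonneg (by positivity), show P - 1 = P - 2 + 1 by ring,
        Real.rpow_add_one h0]
  have hηv : ∀ x, v x * η x = ((‖v x‖ ^ P : ℝ) : ℂ) := fun x => by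
    have : v x * η x = ((‖v x‖ ^ (P - 2) * ‖v x‖ ^ 2 : ℝ) : ℂ) := by
      rw [hη]
      simp only
      rw [mul_left_comm, Complex.mul_conj, Complex.normSq_eq_norm_sq]
      push_cast; rfl
    rw [this]
    congr 1
    by_cases h0 : ‖v x‖ = 0
    · rw [h0, Real.zero_rpow (by linarith : P ≠ 0)]; simp
    · have h1 : 0 < ‖v x‖ := lt_of_le_of_ne (norm_nonneg _) (Ne.symm h0)
      rw [← Real.rpow_natCast, ← Real.rpow_add h1]
      congr 1; push_cast; ring
  have hηm : AEStronglyMeasurable η := by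
    have h1 : AEMeasurable v := hv.1.aemeasurable
    have : AEMeasurable η := by
      rw [hη]; fun_prop
    exact this.aestronglyMeasurable
  have hηP : ∀ x, ‖η x‖ ^ P' = ‖v x‖ ^ P := fun x => by
    rw [hηn, ← Real.rpow_mul (norm_nonneg _), hconj]
  have hvi : Integrable fun x => ‖v x‖ ^ P := hv.integrable_norm_rpow hp0 hp
  have hηL : MemLp η p' := by
    rw [← integrable_norm_rpow_iff hηm hp'0 hp't]
    exact hvi.congr (.of_forall fun x => (hηP x).symm)
  set X : ℝ := ∫ x, ‖v x‖ ^ P with hX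
  set Y : ℕ → ℝ := fun k => ∫ x, (E k).indicator (fun x => ‖v x‖ ^ P) x with hY
  have hX0 : 0 ≤ X := integral_nonneg fun x => by positivity
  set L := K * (eLpNorm b s).toReal with hL
  have hL0 : 0 ≤ L := mul_nonneg hK ENNReal.toReal_nonneg
  -- Pairing `u` with `b η` cut off to `E k` gives `Y k` on the left, while Hölder bounds the `L_q`
  -- norm on the right. In the limit `X ≤ L X^(1/P')`, and `X` is finite as `v ∈ L_p`, so dividing
  -- leaves `‖v‖_p ≤ L`.
  have hYb : ∀ k, Y k ≤ L * Y k ^ P'⁻¹ := by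
    intro k
    have hηE : MemLp ((E k).indicator η) p' :=
      ⟨hηL.1.indicator₀ (hEm k), (eLpNorm_indicator_le _).trans_lt hηL.2⟩
    have hbη : MemLp (fun x => b x * (E k).indicator η x) p' := by
      refine (hηE.norm.const_mul (k : ℝ)).of_le_mul (c := 1) (hb.1.mul hηE.1)
        (.of_forall fun x => ?_)
      by_cases hx : x ∈ E k
      · rw [norm_mul, one_mul, norm_mul, norm_norm, Real.norm_natCast]
        exact mul_le_mul_of_nonneg_right hx.2 (norm_nonneg _)
      · simp [hx]
    have h1 := h _ hbη ((k : ℝ) + 1) (by positivity) fun x hx => by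
      have : x ∉ E k := fun hxE => absurd hxE.1 (not_le.2 hx)
      simp [this]
    have h2 : ∫ x, u x * (b x * (E k).indicator η x) = ((Y k : ℝ) : ℂ) := by
      rw [hY, ← integral_complex_ofReal]
      congr 1; ext x
      by_cases hx : x ∈ E k
      · simp only [Set.indicator_of_mem hx]
        rw [← hηv, hvdef]; ring
      · simp [hx]
    have hY0 : 0 ≤ Y k := integral_nonneg fun x => Set.indicator_nonneg (fun x _ => by positivity) x
    rw [h2, Complex.norm_real, Real.norm_of_nonneg hY0] at h1
    have h3 : (eLpNorm ((E k).indicator η) p').toReal = Y k ^ P'⁻¹ := by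
      rw [hηE.eLpNorm_eq_integral_rpow_norm hp'0 hp't, ENNReal.toReal_ofReal (by positivity)]
      congr 1
      rw [hY]
      congr 1; ext x
      by_cases hx : x ∈ E k
      · simp only [Set.indicator_of_mem hx]; exact hηP x
      · simp only [Set.indicator_of_notMem hx, norm_zero]
        exact Real.zero_rpow hp'r.ne'
    refine h1.trans ?_
    rw [hL, mul_assoc, ← h3, ← ENNReal.toReal_mul]
    refine mul_le_mul_of_nonneg_left (ENNReal.toReal_mono
      (ENNReal.mul_ne_top hb.2.ne hηE.2.ne) ?_) hK
    exact eLpNorm_mul_le_mul_eLpNorm (p := s) (q := p') hb.1 hηE.1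
  have hYlim : Filter.Tendsto Y Filter.atTop (nhds X) := by
    refine tendsto_integral_of_dominated_convergence (fun x => ‖v x‖ ^ P) (fun k => ?_) hvi
      (fun k => .of_forall fun x => ?_) (.of_forall fun x => ?_)
    · exact hvi.1.indicator₀ (hEm k)
    · rw [← Real.norm_of_nonneg (by positivity : 0 ≤ ‖v x‖ ^ P)]
      exact norm_indicator_le_norm_self (fun x => ‖v x‖ ^ P) x
    · obtain ⟨N, hN⟩ := exists_nat_gt (max ‖x‖ ‖b x‖)
      refine tendsto_const_nhds.congr' ?_
      filter_upwards [Filter.eventually_ge_atTop N] with k hk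
      have hk' : (N : ℝ) ≤ k := by exact_mod_cast hk
      have h1 := le_max_left ‖x‖ ‖b x‖
      have h2 := le_max_right ‖x‖ ‖b x‖
      rw [Set.indicator_of_mem]
      exact ⟨by linarith, by linarith⟩
  have hXb : X ≤ L * X ^ P'⁻¹ :=
    le_of_tendsto_of_tendsto' hYlim
      ((hYlim.rpow_const (Or.inr (by positivity))).const_mul L) hYb
  have hnorm : (eLpNorm v p).toReal = X ^ P⁻¹ := by
    rw [hv.eLpNorm_eq_integral_rpow_norm hp0 hp, ENNReal.toReal_ofReal (by positivity)]
  rw [hnorm]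
  rcases hX0.eq_or_lt with h0 | h0
  · rw [← h0, Real.zero_rpow (by positivity)]; exact hL0
  · have h4 : X = X ^ P⁻¹ * X ^ P'⁻¹ := by rw [← Real.rpow_add h0, hinv, Real.rpow_one]
    have h5 : X ^ P⁻¹ * X ^ P'⁻¹ ≤ L * X ^ P'⁻¹ := by rw [← h4]; exact hXb
    exact le_of_mul_le_mul_right h5 (by positivity)

end EigenfunctionEstimate

/-! ### Cancelling the norm of `b u`, and the eigenvalue bound. -/

theorem one_le_mul_of_le_mul {V K B C W A : ℝ} (hV : 0 < V) (hB : 0 ≤ B) (hC : 0 ≤ C)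
    (h : V ≤ K * B) (hK : K = C * W) (hW : W ≤ A * V) : 1 ≤ C * A * B := by
  have h1 : K * B ≤ C * (A * V) * B := by rw [hK]; gcongr
  refine le_of_mul_le_mul_right ?_ hV
  linarith

theorem rpow_le_of_one_le_mul {y α G Γ A B : ℝ} (hy : 0 < y)
    (h : 1 ≤ G * (y⁻¹ ^ α * Γ) * A * B) : y ^ α ≤ G * Γ * A * B := by
  have h1 : y ^ α * y⁻¹ ^ α = 1 := by
    rw [← Real.mul_rpow hy.le (by positivity), mul_inv_cancel₀ hy.ne', Real.one_rpow]
  calc y ^ α = y ^ α * 1 := (mul_one _).symm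
    _ ≤ y ^ α * (G * (y⁻¹ ^ α * Γ) * A * B) := by gcongr
    _ = _ := by linear_combination G * Γ * A * B * h1

/-- The a priori estimate for eigenfunctions of `-Δ + a b` with a non-real eigenvalue. -/
theorem toReal_eLpNorm_mul_le_of_weakEq {n : ℕ} {u a b : EuclideanSpace ℝ (Fin n) → ℂ} {z : ℂ}
    (hz : z.im ≠ 0) {p p' q r s : ℝ≥0∞} [ENNReal.HolderConjugate p p']
    [ENNReal.HolderTriple r p q] [ENNReal.HolderTriple s p' q] (hp1 : 1 < p) (hp : p ≠ ⊤)
    (hq1 : 1 ≤ q) (hq2 : q ≤ 2) {α : ℝ} (hα : α = 1 - (n : ℝ) / 2 * (2 / q.toReal - 1))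
    (hα0 : 0 < α) (ha : MemLp a r) (hb : MemLp b s) (hu : MemLp u p)
    (hv : MemLp (fun x => b x * u x) p)
    (h : WeakEq u (fun x => a x * (b x * u x)) (z • u)) (hu0 : ¬ u =ᵐ[volume] 0) :
    |z.im| ^ α ≤ (4 * Real.pi) ^ (α - 1) * Real.Gamma α *
      (eLpNorm a r volume).toReal * (eLpNorm b s volume).toReal := by
  set v : EuclideanSpace ℝ (Fin n) → ℂ := fun x => b x * u x with hvdef
  have hw : MemLp (fun x => a x * v x) q := MemLp.mul' hv ha
  have hw' : (eLpNorm (fun x => a x * v x) q).toReal ≤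
      (eLpNorm a r).toReal * (eLpNorm v p).toReal := by
    rw [← ENNReal.toReal_mul]
    exact ENNReal.toReal_mono (ENNReal.mul_ne_top ha.2.ne hv.2.ne)
      (eLpNorm_mul_le_mul_eLpNorm ha.1 hv.1)
  have hzp : 0 < |z.im| := abs_pos.2 hz
  have hΓ := Real.Gamma_pos_of_pos hα0
  set C : ℝ := (4 * Real.pi) ^ (α - 1) * (|z.im|⁻¹ ^ α * Real.Gamma α) with hC
  have hC0 : 0 ≤ C := by positivity
  have hp'1 : 1 ≤ p' := ENNReal.HolderConjugate.one_le p' p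
  have hp't : p' ≠ ⊤ := by
    rw [ENNReal.HolderConjugate.ne_top_iff_ne_one p' p]
    exact hp1.ne'
  set K : ℝ := C * (eLpNorm (fun x => a x * v x) q).toReal with hK
  have hK0 : 0 ≤ K := mul_nonneg hC0 ENNReal.toReal_nonneg
  have hα' : α = 1 - (Module.finrank ℝ (EuclideanSpace ℝ (Fin n)) : ℝ) / 2 * (2 / q.toReal - 1) := by
    rw [finrank_euclideanSpace_fin]; exact hα
  have hpair : ∀ ψ : SchwartzMap (EuclideanSpace ℝ (Fin n)) ℂ,
      ‖∫ x, u x * ψ x‖ ≤ K * (eLpNorm ψ q).toReal := by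
    intro ψ
    rw [integral_mul_eq_neg_schwartzResolvent hz h hp1.le hq1 hu hw ψ, norm_neg]
    have h1 := norm_integral_mul_schwartzResolvent_le hz hq1 hq2 hα' hα0 hw ψ
    rw [hK, hC]
    linarith
  have hmain : (eLpNorm v p).toReal ≤ K * (eLpNorm b s).toReal :=
    eLpNorm_mul_le_of_pairing (p' := p') (q := q) hp1 hp hb hv hK0 fun g hg R hR hgR =>
      (norm_integral_mul_le_of_schwartz (s := s) hp't hp'1 hq1 hu hK0 hpair hg hR hgR).2
  -- If `b u` vanished, so would `K`; then `u` would annihilate every test function and be zero.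
  have hvpos : 0 < (eLpNorm v p).toReal := by
    by_contra hcon
    have hv0 : (eLpNorm v p).toReal = 0 := le_antisymm (not_lt.1 hcon) ENNReal.toReal_nonneg
    have hK1 : K = 0 := by
      rw [hv0, mul_zero] at hw'
      rw [hK, le_antisymm hw' ENNReal.toReal_nonneg, mul_zero]
    have hweak : WeakEq 0 0 u := fun φ hφ => by
      have h1 : ‖∫ x, u x * φ x‖ ≤ _ := hpair (hφ.2.toSchwartzMap hφ.1)
      rw [hK1, zero_mul] at h1
      rw [norm_le_zero_iff.1 h1]
      simp
    exact hu0 (hweak.ae_eq_zero (hu.locallyIntegrable hp1.le))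
  exact rpow_le_of_one_le_mul (abs_pos.2 hz) (one_le_mul_of_le_mul hvpos ENNReal.toReal_nonneg hC0
    hmain hK hw')

theorem mainTheorem5 (n : ℕ) (hn : 3 ≤ n) (p r s : ℝ≥0∞) [Fact (1 ≤ p)]
    (hp1 : 1 < p) (hp : p < ⊤) (hr : 0 < r) (hs : p ≤ s)
    (hrs : r⁻¹.toReal - s⁻¹.toReal = 1 - 2 * p⁻¹.toReal)
    (hr1 : 1 / 2 - p⁻¹.toReal ≤ r⁻¹.toReal) (hr2 : r⁻¹.toReal ≤ 1 - p⁻¹.toReal)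
    (hrsn : r⁻¹.toReal + s⁻¹.toReal < 2 / (n : ℝ))
    (a b : EuclideanSpace ℝ (Fin n) → ℂ)
    (ha : MemLp a r volume) (hb : MemLp b s volume)
    (α : ℝ) (hα : α = 1 - n * (r⁻¹.toReal + s⁻¹.toReal) / 2)
    (z : ℂ) (hz : IsEigenvalue (schrodingerOp p a b) z) (hzim : z.im ≠ 0) :
    |z.im| ^ α ≤ (4 * Real.pi) ^ (α - 1) * Real.Gamma α *
      (eLpNorm a r volume).toReal * (eLpNorm b s volume).toReal := by
  obtain ⟨u, hu0, hu⟩ := hz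
  have hgraph : ((u : ComplexLp n p), z • (u : ComplexLp n p)) ∈ schrodingerGraph p a b := by
    rw [← schrodingerOp_graph, ← hu]
    exact (schrodingerOp p a b).mem_graph u
  obtain ⟨hv, -, hweak⟩ := hgraph
  have hpinv : p⁻¹ ≠ ⊤ := ENNReal.inv_ne_top.2 (zero_lt_one.trans hp1).ne'
  have hrinv : r⁻¹ ≠ ⊤ := ENNReal.inv_ne_top.2 hr.ne'
  have hsinv : s⁻¹ ≠ ⊤ := ENNReal.inv_ne_top.2 ((zero_lt_one.trans hp1).trans_le hs).ne'
  have hconj : ENNReal.HolderConjugate p (ENNReal.conjExponent p) :=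
    ENNReal.HolderConjugate.conjExponent hp1.le
  set p' := ENNReal.conjExponent p
  have hp'inv : p'⁻¹ ≠ ⊤ := ENNReal.inv_ne_top.2 (ENNReal.HolderConjugate.ne_zero p' p)
  have hpp' : p⁻¹.toReal + p'⁻¹.toReal = 1 := by
    rw [← ENNReal.toReal_add hpinv hp'inv, ENNReal.HolderConjugate.inv_add_inv_eq_one,
      ENNReal.toReal_one]
  -- The relation between `r`, `s` and `p` says exactly that `1/s + 1/p'` equals this same `1/q`,
  -- and the two-sided bound on `1/r` says `1 ≤ q ≤ 2`.
  set q : ℝ≥0∞ := (r⁻¹ + p⁻¹)⁻¹ with hq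
  have hqinv : q⁻¹ = r⁻¹ + p⁻¹ := by rw [hq, inv_inv]
  have hqr : q⁻¹.toReal = r⁻¹.toReal + p⁻¹.toReal := by
    rw [hqinv, ENNReal.toReal_add hrinv hpinv]
  have hqinvt : q⁻¹ ≠ ⊤ := by rw [hqinv]; exact ENNReal.add_ne_top.2 ⟨hrinv, hpinv⟩
  have t1 : ENNReal.HolderTriple r p q := ⟨hqinv.symm⟩
  have t2 : ENNReal.HolderTriple s p' q := by
    refine ⟨(ENNReal.toReal_eq_toReal_iff' (ENNReal.add_ne_top.2 ⟨hsinv, hp'inv⟩) hqinvt).1 ?_⟩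
    rw [ENNReal.toReal_add hsinv hp'inv, hqr]
    linarith
  have hq1 : 1 ≤ q := by
    rw [← ENNReal.inv_le_inv, inv_one, ← ENNReal.toReal_le_toReal hqinvt ENNReal.one_ne_top, hqr,
      ENNReal.toReal_one]
    linarith
  have hq2 : q ≤ 2 := by
    rw [← ENNReal.inv_le_inv, ← ENNReal.toReal_le_toReal (by simp) hqinvt, hqr]
    simp only [ENNReal.toReal_inv, ENNReal.toReal_ofNat] at hr1 ⊢
    linarith
  have hn0 : (0 : ℝ) < n := by
    have : 0 < n := by omega
    exact_mod_cast this
  refine toReal_eLpNorm_mul_le_of_weakEq (p := p) (p' := p') (q := q) (u := u.1) hzim hp1 hp.ne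
    hq1 hq2 ?_ ?_ ha hb (Lp.memLp _) hv ?_ ?_
  · rw [div_eq_mul_inv 2 q.toReal, ← ENNReal.toReal_inv, hqr, hα]
    linear_combination (n : ℝ) / 2 * hrs
  -- Positivity of `α` is the condition `1/r + 1/s < 2/n`.
  · rw [lt_div_iff₀ hn0] at hrsn
    rw [hα]
    linarith
  · exact hweak.congr (Filter.EventuallyEq.refl _ _) (Filter.EventuallyEq.refl _ _)
      (Lp.coeFn_smul z u.1).symm
  · exact fun h => hu0 ((Lp.eq_zero_iff_ae_eq_zero).2 h)
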